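/- Let $d\ge 1$ be an integer, let $s\ge d/2$ be real, and put $n=\lfloor s-\tfrac d2\rfloor$. For $0\le V\in C_0^\infty(\mathbb R^d)$ (real-valued, smooth, compactly supported), let $H_s=(-\Delta)^s-V$ be the self-adjoint operator on $L^2(\mathbb R^d)$ with domain $H^{2s}(\mathbb R^d)$, let $N_{<0}(H_s)$ be the number of its negative eigenvalues counted with multiplicity, and let $\mathcal F_n=\mathrm{span}\{x^\alpha\sqrt V : \alpha\in\mathbb N_0^d,\ |\alpha|\le n\}\subset L^2(\mathbb R^d)$. Then: 1. For every $0\le V\in C_0^\infty(\mathbb R^d)$, one has $N_{<0}(H_s)\ge \dim\mathcal F_n$. 2. There is $0\le V\in C_0^\infty(\mathbb R^d)$ for which $\dim\mathcal F_n=\binom{d+n}{d}$. 3. Suppose $s>d/2$, write $\langle x\rangle=\sqrt{1+|x|^2}$, and set $w(x)=|x|^{s-d/2}$ if $s-\frac d2\notin\mathbb N$, and $w(x)=\langle x\rangle^{s-d/2}\sqrt{1+\ln\langle x\rangle}$ if $s-\frac d2\in\mathbb N$. Then the additive constant $\binom{d+n}{d}$ in the bound $N_{<0}(H_s)-\binom{d+n}{d}\le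 C_{d,s}\,\|w\sqrt V\|_{L^2}^2$ cannot be removed or lowered: for every real $0\le a<\binom{d+n}{d}$ there is no constant $C\ge 0$ such that $N_{<0}(H_s)\le a+C\,\|w\sqrt V\|_{L^2}^2$ for all $0\le V\in C_0^\infty(\mathbb R^d)$. -/

import Mathlib

open MeasureTheory
open scoped FourierTransform ENNReal NNReal ContDiff

noncomputable section

/-- The Hilbert space `L²(ℝᵈ; ℂ)`, with Lebesgue measure. -/
abbrev L2Space (d : ℕ) : Type := Lp (α := EuclideanSpace ℝ (Fin d)) ℂ 2 volume

/-- The domain `{u ∈ L² | m u ∈ L²}` of the operator of multiplication by `m`. -/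
def mulDomain (d : ℕ) (m : EuclideanSpace ℝ (Fin d) → ℝ) : Submodule ℂ (L2Space d) where
  carrier := {u | MemLp (fun x => (m x : ℂ) * u x) 2 volume}
  add_mem' := by
    intro u w hu hw
    refine (MemLp.add hu hw).ae_eq ?_
    filter_upwards [Lp.coeFn_add u w] with x hx
    simp only [Pi.add_apply, hx, mul_add]
  zero_mem' := by
    refine (MemLp.zero (ε := ℂ) (p := 2)
      (μ := (volume : Measure (EuclideanSpace ℝ (Fin d))))).ae_eq ?_
    filter_upwards [Lp.coeFn_zero ℂ 2
      (volume : Measure (EuclideanSpace ℝ (Fin d)))] with x hx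
    simp
  smul_mem' := by
    intro c u hu
    refine (MemLp.const_smul hu c).ae_eq ?_
    filter_upwards [Lp.coeFn_smul c u] with x hx
    simp only [Pi.smul_apply, hx, smul_eq_mul]
    ring

/-- The maximal operator of multiplication by the real function `m` on `L²(ℝᵈ)`:
its domain is `{u ∈ L² | m u ∈ L²}`, and it sends `u` to `m u`. -/
def mulOp (d : ℕ) (m : EuclideanSpace ℝ (Fin d) → ℝ) : L2Space d →ₗ.[ℂ] L2Space d where
  domain := mulDomain d m
  toFun :=
    { toFun := fun u => MemLp.toLp (fun x => (m x : ℂ) * u.1 x) u.2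
      map_add' := by
        intro u w
        apply Lp.ext
        filter_upwards [Lp.coeFn_add u.1 w.1, MemLp.coeFn_toLp (u + w).2, MemLp.coeFn_toLp u.2,
          MemLp.coeFn_toLp w.2, Lp.coeFn_add (MemLp.toLp _ u.2) (MemLp.toLp _ w.2)]
          with x h1 h2 h3 h4 h5
        rw [h2, h5, Pi.add_apply, h3, h4, Submodule.coe_add, h1, Pi.add_apply, mul_add]
      map_smul' := by
        intro c u
        apply Lp.ext
        filter_upwards [Lp.coeFn_smul c u.1, MemLp.coeFn_toLp (c • u).2, MemLp.coeFn_toLp u.2,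
          Lp.coeFn_smul c (MemLp.toLp _ u.2)] with x h1 h2 h3 h4
        rw [h2, RingHom.id_apply, h4, Pi.smul_apply, h3, Submodule.coe_smul, h1, Pi.smul_apply,
          smul_eq_mul, smul_eq_mul, mul_left_comm] }

/-- The fractional Laplacian `(-Δ)^s` on `L²(ℝᵈ)`, i.e. `𝓕⁻¹ |2πξ|^{2s} 𝓕` for the unitary Fourier
transform with kernel `exp(-2πi x·ξ)`, on its maximal domain
`{u ∈ L² | |ξ|^{2s} 𝓕u ∈ L²}`, which is the Sobolev space `H^{2s}(ℝᵈ)`. -/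
def fracLaplacian (d : ℕ) (s : ℝ) : L2Space d →ₗ.[ℂ] L2Space d :=
  let F := Lp.fourierTransformₗᵢ (EuclideanSpace ℝ (Fin d)) ℂ
  let M := mulOp d (fun ξ => (2 * Real.pi * ‖ξ‖) ^ (2 * s))
  { domain := M.domain.comap F.toLinearEquiv.toLinearMap
    toFun := F.symm.toLinearEquiv.toLinearMap ∘ₗ M.toFun ∘ₗ
      F.toLinearEquiv.toLinearMap.restrict (fun _ hu => hu) }

/-- The operator `H_s = (-Δ)^s - V` on `L²(ℝᵈ)`, as an operator difference: its domain is the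
intersection of the domains of `(-Δ)^s` and of multiplication by `V`. For bounded measurable `V`
this is the self-adjoint operator with domain `H^{2s}(ℝᵈ)`. -/
def fracSchrodinger (d : ℕ) (s : ℝ) (V : EuclideanSpace ℝ (Fin d) → ℝ) :
    L2Space d →ₗ.[ℂ] L2Space d :=
  fracLaplacian d s - mulOp d V

/-- The eigenspace `ker (T - E)` of an unbounded operator, as a subspace of the domain of `T`. -/
def pmapEigenspace {H : Type*} [AddCommGroup H] [Module ℂ H] (T : H →ₗ.[ℂ] H) (E : ℝ) :
    Submodule ℂ T.domain :=
  LinearMap.ker (T.toFun - (E : ℂ) • T.domain.subtype)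

/-- The dimension of a complex vector space, in `ℕ ∪ {∞}`. -/
def dimENat (W : Type*) [AddCommGroup W] [Module ℂ W] : ℕ∞ :=
  Cardinal.toENat (Module.rank ℂ W)

/-- `N_{<0}(T) = ∑_{E < 0} dim ker (T - E)`: the number, in `ℕ ∪ {∞}`, of negative eigenvalues
of `T` counted with multiplicity (a sum of nonnegative terms, as supremum of its finite sums). -/
def numNegEigenvalues {H : Type*} [AddCommGroup H] [Module ℂ H] (T : H →ₗ.[ℂ] H) : ℕ∞ :=
  ⨆ S : Finset (Set.Iio (0 : ℝ)), ∑ E ∈ S, dimENat (pmapEigenspace T E)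

/-- `𝓕_n = span {x^α √V : α ∈ ℕ₀ᵈ, |α| ≤ n}`, as a subspace of `L²(ℝᵈ)`. -/
def polySpan (d n : ℕ) (V : EuclideanSpace ℝ (Fin d) → ℝ) : Submodule ℂ (L2Space d) :=
  Submodule.span ℂ {u | ∃ α : Fin d → ℕ, ∑ i, α i ≤ n ∧
    (u : EuclideanSpace ℝ (Fin d) → ℂ) =ᵐ[volume]
      fun x => (((∏ i, x i ^ α i) * √(V x) : ℝ) : ℂ)}

/-- Real-valued `V ∈ C₀^∞(ℝᵈ)` (smooth with compact support) with `V ≥ 0`. -/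
structure IsTestPotential {d : ℕ} (V : EuclideanSpace ℝ (Fin d) → ℝ) : Prop where
  smooth : ContDiff ℝ ∞ V
  compact_support : HasCompactSupport V
  nonneg : ∀ x, 0 ≤ V x

open Classical in
/-- The weight, where `⟨x⟩ = √(1 + |x|²)`: it is `⟨x⟩^{s-d/2} √(1 + ln ⟨x⟩)` if `s - d/2` is an
integer, and `|x|^{s-d/2}` otherwise (used for `s > d/2`). -/
def boundWeight (d : ℕ) (s : ℝ) (x : EuclideanSpace ℝ (Fin d)) : ℝ :=
  if ∃ k : ℕ, s - (d : ℝ) / 2 = k then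
    √(1 + ‖x‖ ^ 2) ^ (s - (d : ℝ) / 2) * √(1 + Real.log √(1 + ‖x‖ ^ 2))
  else ‖x‖ ^ (s - (d : ℝ) / 2)

/-- The squared weighted norm `‖w √V‖²_{L²}`, in `[0, ∞]`, with `w` the weight above. -/
def weightedNormSq (d : ℕ) (s : ℝ) (V : EuclideanSpace ℝ (Fin d) → ℝ) : ℝ≥0∞ :=
  eLpNorm (fun x => boundWeight d s x * √(V x)) 2 volume ^ 2

end

/-! The lower bound is a variational argument of Birman–Schwinger type. For `f ∈ 𝓕_n` put `ψ = √V f`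
and let `R_e` be the resolvent of `(-Δ)^s` at `-e`. As `e → 0`, `⟨R_e ψ, ψ⟩` increases to `∫ |𝓕ψ|²
(2π|ξ|)^{-2s}`. If every moment of `ψ` of order at most `n` vanished, `f` would be orthogonal to
`𝓕_n`, hence to itself. So a nonzero `f` has a lowest nonvanishing moment order `j ≤ n`, and near
the origin `|𝓕ψ|²` has leading size `|ξ|^{2j}` along the rays where that moment is nonzero. Since
`2j - 2s ≤ -d`, the integral diverges (`lintegral_fourier_sq_div_eq_top`). Compactness of the unit
sphere of `𝓕_n` then gives one `e` with `⟨R_e √V f, √V f⟩ > ‖f‖²` for all nonzero `f`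
(`exists_uniform_lt_energy`).

The trial functions are `φ = R_e √V f`. By Cauchy–Schwarz the inequality above makes the quadratic
form of `H_s` negative at `φ`. If there were fewer than `dim 𝓕_n` negative eigenvalues, a dimension
count would give such a `φ` orthogonal to all the corresponding eigenvectors. But negativity of the
form on that orthogonal complement produces another negative eigenvector there
(`exists_negative_eigenvector_orthogonal`), because `V` is relatively compact
(`exists_subseq_bcfMul_fourierMul_tendsto`); this is a contradiction.

For a potential positive on a cube the monomials `x^α √V` are linearly independent, so `dim 𝓕_n` is
the full binomial coefficient. Replacing `V` by `tV` with `t → 0` keeps this dimension but sends the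
weighted norm to zero, so the additive constant cannot be lowered. -/

/-! ### Eigenvectors from a negative quadratic form, in an abstract Hilbert space. -/

section AbstractSpectral

open Filter Topology
open scoped InnerProductSpace

variable {H : Type*} [NormedAddCommGroup H] [InnerProductSpace ℂ H]

/-- A nonnegative quadratic form controls the norm of the operator. -/
theorem norm_sq_le_of_rayleigh_nonneg (P : H →L[ℂ] H) (M : Submodule ℂ H)
    (hP : ∀ u v, ⟪P u, v⟫_ℂ = ⟪u, P v⟫_ℂ) (hPM : ∀ u ∈ M, P u ∈ M)
    (hpos : ∀ u ∈ M, 0 ≤ (⟪P u, u⟫_ℂ).re) {u : H} (hu : u ∈ M) :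
    ‖P u‖ ^ 2 ≤ (‖P‖ + 1) * (⟪P u, u⟫_ℂ).re := by
  -- The form is tested on `u - t P u`. The `+ 1` keeps `t` meaningful when `P = 0`.
  set t : ℝ := (‖P‖ + 1)⁻¹ with ht
  have hn : 0 ≤ ‖P‖ := norm_nonneg P
  have h1 := hpos (u - (t : ℂ) • P u) (M.sub_mem hu (M.smul_mem _ (hPM u hu)))
  have hb : (⟪P (P u), P u⟫_ℂ).re ≤ ‖P‖ * ‖P u‖ ^ 2 := by
    calc (⟪P (P u), P u⟫_ℂ).re ≤ ‖⟪P (P u), P u⟫_ℂ‖ := Complex.re_le_norm _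
      _ ≤ ‖P (P u)‖ * ‖P u‖ := norm_inner_le_norm _ _
      _ ≤ (‖P‖ * ‖P u‖) * ‖P u‖ := by gcongr; exact P.le_opNorm _
      _ = _ := by ring
  have hPu : (⟪P u, P u⟫_ℂ).re = ‖P u‖ ^ 2 := by
    rw [inner_self_eq_norm_sq_to_K]; norm_cast
  have h2 : (⟪P (u - (t : ℂ) • P u), u - (t : ℂ) • P u⟫_ℂ).re =
      (⟪P u, u⟫_ℂ).re - 2 * t * ‖P u‖ ^ 2 + t ^ 2 * (⟪P (P u), P u⟫_ℂ).re := by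
    have h3 : ⟪P (P u), u⟫_ℂ = ⟪P u, P u⟫_ℂ := hP _ _
    simp only [map_sub, map_smul, inner_sub_left, inner_sub_right, inner_smul_left,
      inner_smul_right, h3, Complex.conj_ofReal, Complex.sub_re, Complex.mul_re,
      Complex.ofReal_re, Complex.ofReal_im, zero_mul, sub_zero, hPu]
    ring
  rw [h2] at h1
  have ht1 : t * (‖P‖ + 1) = 1 := inv_mul_cancel₀ (by positivity)
  have ht0 : 0 < t := by positivity
  have h5 : t * ‖P u‖ ^ 2 ≤ (⟪P u, u⟫_ℂ).re := by
    have : t ^ 2 * (⟪P (P u), P u⟫_ℂ).re ≤ t ^ 2 * (‖P‖ * ‖P u‖ ^ 2) := by gcongr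
    have h6 : t ^ 2 * (‖P‖ * ‖P u‖ ^ 2) = t * ‖P u‖ ^ 2 - t ^ 2 * ‖P u‖ ^ 2 := by
      have : t * ‖P‖ = 1 - t := by linarith
      calc _ = t * (t * ‖P‖) * ‖P u‖ ^ 2 := by ring
        _ = _ := by rw [this]; ring
    have : 0 ≤ t ^ 2 * ‖P u‖ ^ 2 := by positivity
    linarith
  calc ‖P u‖ ^ 2 = (‖P‖ + 1) * (t * ‖P u‖ ^ 2) := by rw [← mul_assoc, mul_comm _ t, ht1, one_mul]
    _ ≤ _ := by gcongr

variable [CompleteSpace H]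

/-- A bounded symmetric operator that is the sum of an operator `≤ b` and a compact operator has
an eigenvector with eigenvalue above `b` in every closed invariant subspace on which its quadratic
form exceeds `b` somewhere. -/
theorem exists_eigenvector_of_lt_rayleigh (B R K : H →L[ℂ] H)
    (hB : ∀ u v, ⟪B u, v⟫_ℂ = ⟪u, B v⟫_ℂ) (M : Submodule ℂ H) (hM : IsClosed (M : Set H))
    (hBM : ∀ u ∈ M, B u ∈ M) (b : ℝ) (hBRK : ∀ u, B u = R u + K u)
    (hR : ∀ u, (⟪R u, u⟫_ℂ).re ≤ b * ‖u‖ ^ 2)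
    (hK : ∀ u : ℕ → H, (∀ n, ‖u n‖ = 1) → ∃ φ : ℕ → ℕ, StrictMono φ ∧
      ∃ y, Tendsto (fun n => K (u (φ n))) atTop (𝓝 y))
    {v : H} (hv : v ∈ M) (hbv : b * ‖v‖ ^ 2 < (⟪B v, v⟫_ℂ).re) :
    ∃ μ : ℝ, b < μ ∧ ∃ u ∈ M, u ≠ 0 ∧ B u = (μ : ℂ) • u := by
  have hv0 : v ≠ 0 := by rintro rfl; simp at hbv
  have hvn : 0 < ‖v‖ := norm_pos_iff.mpr hv0
  set S : Set ℝ := {r | ∃ u ∈ M, ‖u‖ = 1 ∧ r = (⟪B u, u⟫_ℂ).re} with hS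
  have hscale : ∀ u ∈ M, u ≠ 0 → (⟪B u, u⟫_ℂ).re / ‖u‖ ^ 2 ∈ S := by
    intro u hu hu0
    have hun : 0 < ‖u‖ := norm_pos_iff.mpr hu0
    refine ⟨((‖u‖⁻¹ : ℝ) : ℂ) • u, M.smul_mem _ hu, ?_, ?_⟩
    · rw [norm_smul, Complex.norm_real, norm_inv, norm_norm, inv_mul_cancel₀ hun.ne']
    · simp only [map_smul, inner_smul_left, inner_smul_right, Complex.conj_ofReal,
        Complex.re_ofReal_mul]
      field_simp
  have hSb : BddAbove S := by
    refine ⟨‖B‖, ?_⟩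
    rintro r ⟨u, -, hu1, rfl⟩
    calc (⟪B u, u⟫_ℂ).re ≤ ‖⟪B u, u⟫_ℂ‖ := Complex.re_le_norm _
      _ ≤ ‖B u‖ * ‖u‖ := norm_inner_le_norm _ _
      _ ≤ (‖B‖ * ‖u‖) * ‖u‖ := by gcongr; exact B.le_opNorm _
      _ = _ := by rw [hu1]; ring
  set μ := sSup S with hμ
  have hbμ : b < μ := by
    refine lt_of_lt_of_le ?_ (le_csSup hSb (hscale v hv hv0))
    rwa [lt_div_iff₀ (by positivity)]
  have hSne : S.Nonempty := ⟨_, hscale v hv hv0⟩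
  -- `μ` is the supremum of the Rayleigh quotient on `M`, so `P` is nonnegative there. Along a
  -- maximizing sequence its form tends to zero, hence so does `P u`.
  set P : H →L[ℂ] H := (μ : ℂ) • ContinuousLinearMap.id ℂ H - B with hPdef
  have hPa : ∀ u, P u = (μ : ℂ) • u - B u := fun u => by simp [hPdef]
  have hself : ∀ u : H, (⟪u, u⟫_ℂ).re = ‖u‖ ^ 2 := fun u => by
    rw [inner_self_eq_norm_sq_to_K]; norm_cast
  have hPre : ∀ u, (⟪P u, u⟫_ℂ).re = μ * ‖u‖ ^ 2 - (⟪B u, u⟫_ℂ).re := fun u => by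
    rw [hPa, inner_sub_left, inner_smul_left, Complex.conj_ofReal, Complex.sub_re,
      Complex.re_ofReal_mul, hself]
  have hPsym : ∀ u w, ⟪P u, w⟫_ℂ = ⟪u, P w⟫_ℂ := fun u w => by
    simp only [hPa, inner_sub_left, inner_sub_right, inner_smul_left, inner_smul_right,
      Complex.conj_ofReal, hB]
  have hPM : ∀ u ∈ M, P u ∈ M := fun u hu => by
    rw [hPa]; exact M.sub_mem (M.smul_mem _ hu) (hBM u hu)
  have hPpos : ∀ u ∈ M, 0 ≤ (⟪P u, u⟫_ℂ).re := fun u hu => by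
    rw [hPre]
    by_cases hu0 : u = 0
    · simp [hu0]
    · have hun : 0 < ‖u‖ := norm_pos_iff.mpr hu0
      have := le_csSup hSb (hscale u hu hu0)
      rw [div_le_iff₀ (by positivity)] at this
      linarith
  obtain ⟨r, -, hrt, hrS⟩ := exists_seq_tendsto_sSup hSne hSb
  choose u huM hu1 hru using hrS
  obtain ⟨φ, hφ, y, hy⟩ := hK u hu1
  have hPu0 : Tendsto (fun n => P (u n)) atTop (𝓝 0) := by
    rw [tendsto_zero_iff_norm_tendsto_zero]
    have h1 : Tendsto (fun n => ‖P (u n)‖ ^ 2) atTop (𝓝 0) := by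
      have h2 : Tendsto (fun n => (‖P‖ + 1) * (μ - r n)) atTop (𝓝 0) := by
        have := (tendsto_const_nhds (x := μ)).sub hrt
        rw [sub_self] at this
        simpa using this.const_mul (‖P‖ + 1)
      refine squeeze_zero (fun n => by positivity) (fun n => ?_) h2
      have := norm_sq_le_of_rayleigh_nonneg P M hPsym hPM hPpos (huM n)
      rwa [hPre, hu1, ← hru, one_pow, mul_one] at this
    have := h1.sqrt
    simpa using this
  -- `Q = P + K` converges along the subsequence, and `Q` is bounded below by `μ - b > 0`. Thus the
  -- maximizing subsequence is itself Cauchy.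
  set Q : H →L[ℂ] H := (μ : ℂ) • ContinuousLinearMap.id ℂ H - R with hQdef
  have hQa : ∀ u, Q u = (μ : ℂ) • u - R u := fun u => by simp [hQdef]
  have hQP : ∀ u, Q u = P u + K u := fun u => by rw [hQa, hPa, hBRK]; abel
  have hQt : Tendsto (fun n => Q (u (φ n))) atTop (𝓝 y) := by
    have := (hPu0.comp hφ.tendsto_atTop).add hy
    rw [zero_add] at this
    exact this.congr fun n => (hQP _).symm
  have hQlow : ∀ w, (μ - b) * ‖w‖ ≤ ‖Q w‖ := fun w => by
    by_cases hw : w = 0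
    · simp [hw]
    have hwn : 0 < ‖w‖ := norm_pos_iff.mpr hw
    have h1 : (⟪Q w, w⟫_ℂ).re = μ * ‖w‖ ^ 2 - (⟪R w, w⟫_ℂ).re := by
      rw [hQa, inner_sub_left, inner_smul_left, Complex.conj_ofReal, Complex.sub_re,
        Complex.re_ofReal_mul, hself]
    have h2 : (⟪Q w, w⟫_ℂ).re ≤ ‖Q w‖ * ‖w‖ :=
      (Complex.re_le_norm _).trans (norm_inner_le_norm _ _)
    have h3 := hR w
    refine le_of_mul_le_mul_right ?_ hwn
    nlinarith
  have hδ : 0 < μ - b := sub_pos.mpr hbμ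
  have hcau : CauchySeq (fun n => u (φ n)) := by
    have hQc := hQt.cauchySeq
    rw [Metric.cauchySeq_iff'] at hQc ⊢
    intro ε hε
    obtain ⟨N, hN⟩ := hQc ((μ - b) * ε) (by positivity)
    refine ⟨N, fun n hn => ?_⟩
    have h1 := hN n hn
    rw [dist_eq_norm, ← map_sub] at h1
    rw [dist_eq_norm]
    exact lt_of_mul_lt_mul_left ((hQlow _).trans_lt h1) hδ.le
  obtain ⟨z, hz⟩ := cauchySeq_tendsto_of_complete hcau
  refine ⟨μ, hbμ, z, hM.mem_of_tendsto hz (Eventually.of_forall fun n => huM _), ?_, ?_⟩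
  · rintro rfl
    have := hz.norm
    simp only [hu1, norm_zero] at this
    exact one_ne_zero (tendsto_nhds_unique tendsto_const_nhds this)
  · have h1 := (P.continuous.tendsto z).comp hz
    have h2 := tendsto_nhds_unique h1 (hPu0.comp hφ.tendsto_atTop)
    rw [hPa, sub_eq_zero] at h2
    exact h2.symm

/-- Let `R` be the resolvent at `-c` of a nonnegative operator `T`, and `V` a bounded symmetric
operator with `V ≤ c` that is compact relative to `T`. If the quadratic form of `T - V` is negative
somewhere on the orthogonal complement of the span of a set of eigenvectors, then that complement
contains an eigenvector with negative eigenvalue. -/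
theorem exists_negative_eigenvector_orthogonal (R V : H →L[ℂ] H) {c : ℝ} (hc : 0 < c)
    (hR : ∀ u v, ⟪R u, v⟫_ℂ = ⟪u, R v⟫_ℂ) (hV : ∀ u v, ⟪V u, v⟫_ℂ = ⟪u, V v⟫_ℂ)
    (hRc : ∀ u, c * ‖R u‖ ^ 2 ≤ (⟪R u, u⟫_ℂ).re) (hVc : ∀ u, (⟪V u, u⟫_ℂ).re ≤ c * ‖u‖ ^ 2)
    (hVR : ‖V * R‖ < 1)
    (hK : ∀ u : ℕ → H, (∀ n, ‖u n‖ = 1) → ∃ φ : ℕ → ℕ, StrictMono φ ∧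
      ∃ y, Tendsto (fun n => V (R (u (φ n)))) atTop (𝓝 y))
    (S : Set H) (hS : ∀ u ∈ S, ∃ E : ℝ, ∃ w, R w = u ∧ w - (c : ℂ) • u - V u = (E : ℂ) • u)
    {w₀ : H} (hw₀ : R w₀ ∈ (Submodule.span ℂ S)ᗮ)
    (hneg : (⟪w₀ - (c : ℂ) • R w₀ - V (R w₀), R w₀⟫_ℂ).re < 0) :
    ∃ E : ℝ, E < 0 ∧ ∃ u ∈ (Submodule.span ℂ S)ᗮ, u ≠ 0 ∧
      ∃ w, R w = u ∧ w - (c : ℂ) • u - V u = (E : ℂ) • u := by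
  have hself : ∀ u : H, (⟪u, u⟫_ℂ).re = ‖u‖ ^ 2 := fun u => by
    rw [inner_self_eq_norm_sq_to_K]; norm_cast
  obtain ⟨N, hN⟩ := isUnit_one_sub_of_norm_lt_one hVR
  have hN1 : ∀ u, (↑N⁻¹ : H →L[ℂ] H) (u - V (R u)) = u := fun u => by
    have := congrArg (fun A : H →L[ℂ] H => A u) N.inv_mul
    simpa [hN] using this
  have hN2 : ∀ u, (↑N⁻¹ : H →L[ℂ] H) u - V (R ((↑N⁻¹ : H →L[ℂ] H) u)) = u := fun u => by
    have := congrArg (fun A : H →L[ℂ] H => A u) N.mul_inv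
    simpa [hN] using this
  -- `B = R (1 - V R)⁻¹` is the resolvent of `T - V` at `-c`: negative eigenvalues `E > -c` of `T -
  -- V` correspond to eigenvalues `(E + c)⁻¹ > c⁻¹` of `B`.
  set B : H →L[ℂ] H := R * ↑N⁻¹ with hBdef
  have hBa : ∀ u, B u = R ((↑N⁻¹ : H →L[ℂ] H) u) := fun u => rfl
  have hB1 : ∀ u, B (u - V (R u)) = R u := fun u => by rw [hBa, hN1]
  have hBsym : ∀ u v, ⟪B u, v⟫_ℂ = ⟪u, B v⟫_ℂ := fun u v => by
    rw [hBa, hBa]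
    set a := (↑N⁻¹ : H →L[ℂ] H) u with ha
    set e := (↑N⁻¹ : H →L[ℂ] H) v with he
    have h1 : u = a - V (R a) := (hN2 u).symm
    have h2 : v = e - V (R e) := (hN2 v).symm
    rw [h1, h2, inner_sub_left, inner_sub_right, hR, hV]
  have hBpos : ∀ u, 0 ≤ (⟪B u, u⟫_ℂ).re := fun u => by
    rw [hBa]
    set a := (↑N⁻¹ : H →L[ℂ] H) u with ha
    have h1 : u = a - V (R a) := (hN2 u).symm
    rw [h1, inner_sub_right, Complex.sub_re, ← hV]
    have := hRc a
    have := hVc (R a)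
    linarith
  -- The second resolvent identity writes `B` as `R ≤ c⁻¹` plus a compact operator.
  have hBRK : ∀ u, B u = R u + (B * (V * R)) u := fun u => by
    have : R u = B u - (B * (V * R)) u := by
      rw [← hB1 u, map_sub]; rfl
    rw [this]; abel
  have hRle : ∀ u, (⟪R u, u⟫_ℂ).re ≤ c⁻¹ * ‖u‖ ^ 2 := fun u => by
    have h1 : (⟪R u, u⟫_ℂ).re ≤ ‖R u‖ * ‖u‖ :=
      (Complex.re_le_norm _).trans (norm_inner_le_norm _ _)
    have h2 : c * ‖R u‖ ≤ ‖u‖ := by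
      by_cases h0 : ‖R u‖ = 0
      · rw [h0, mul_zero]; exact norm_nonneg _
      have h3 : 0 < ‖R u‖ := lt_of_le_of_ne (norm_nonneg _) (Ne.symm h0)
      refine le_of_mul_le_mul_right ?_ h3
      have := hRc u
      nlinarith
    have h3 : ‖R u‖ ≤ c⁻¹ * ‖u‖ := by
      rw [inv_mul_eq_div, le_div_iff₀ hc]; linarith
    calc _ ≤ ‖R u‖ * ‖u‖ := h1
      _ ≤ (c⁻¹ * ‖u‖) * ‖u‖ := by gcongr
      _ = _ := by ring
  have hBS : ∀ u ∈ S, B u ∈ Submodule.span ℂ S := fun u hu => by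
    obtain ⟨E, w, rfl, hw⟩ := hS u hu
    have h1 : B (w - V (R w)) = ((E + c : ℝ) : ℂ) • B (R w) := by
      rw [← map_smul]
      congr 1
      push_cast
      rw [add_smul, ← hw]; abel
    rw [hB1] at h1
    -- In the degenerate case the eigenvector is zero.
    by_cases hE : E + c = 0
    · rw [hE, Complex.ofReal_zero, zero_smul] at h1
      rw [h1, map_zero]; exact Submodule.zero_mem _
    · have : B (R w) = ((E + c : ℝ) : ℂ)⁻¹ • R w := by
        rw [h1, smul_smul, inv_mul_cancel₀ (by exact_mod_cast hE), one_smul, ← h1]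
      rw [this]
      exact Submodule.smul_mem _ _ (Submodule.subset_span hu)
  have hBspan : ∀ u ∈ Submodule.span ℂ S, B u ∈ Submodule.span ℂ S := fun u hu => by
    have : Submodule.span ℂ S ≤ (Submodule.span ℂ S).comap (B : H →ₗ[ℂ] H) :=
      Submodule.span_le.mpr hBS
    exact this hu
  have hBperp : ∀ u ∈ (Submodule.span ℂ S)ᗮ, B u ∈ (Submodule.span ℂ S)ᗮ := fun u hu => by
    rw [Submodule.mem_orthogonal] at hu ⊢
    intro v hv
    rw [← hBsym]
    exact hu _ (hBspan v hv)
  have hKB : ∀ u : ℕ → H, (∀ n, ‖u n‖ = 1) → ∃ φ : ℕ → ℕ, StrictMono φ ∧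
      ∃ y, Tendsto (fun n => (B * (V * R)) (u (φ n))) atTop (𝓝 y) := fun u hu => by
    obtain ⟨φ, hφ, y, hy⟩ := hK u hu
    exact ⟨φ, hφ, B y, (B.continuous.tendsto y).comp hy⟩
  -- With `φ = R w₀ = B g`, nonnegativity of `B` at `g - c φ` plays the role of Cauchy–Schwarz: if
  -- the claim failed, it would give `⟨g, φ⟩ ≥ c ‖φ‖²`, against the negativity of `⟨g - c φ, φ⟩`.
  have hbv : c⁻¹ * ‖R w₀‖ ^ 2 < (⟪B (R w₀), R w₀⟫_ℂ).re := by
    by_contra! hle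
    set g := w₀ - V (R w₀) with hg
    have hBg : B g = R w₀ := hB1 w₀
    have h1 := hBpos (g - (c : ℂ) • R w₀)
    have h2 : (⟪B (g - (c : ℂ) • R w₀), g - (c : ℂ) • R w₀⟫_ℂ).re =
        (⟪g, R w₀⟫_ℂ).re - 2 * c * ‖R w₀‖ ^ 2 + c ^ 2 * (⟪B (R w₀), R w₀⟫_ℂ).re := by
      have h3 : ⟪B (R w₀), g⟫_ℂ = ⟪R w₀, R w₀⟫_ℂ := by rw [hBsym, hBg]
      have h4 : (⟪R w₀, g⟫_ℂ).re = (⟪g, R w₀⟫_ℂ).re := inner_re_symm (𝕜 := ℂ) _ _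
      simp only [map_sub, map_smul, inner_sub_left, inner_sub_right, inner_smul_left,
        inner_smul_right, h3, Complex.conj_ofReal, Complex.sub_re, Complex.mul_re,
        Complex.ofReal_re, Complex.ofReal_im, zero_mul, sub_zero, hBg,
        h4, hself]
      ring
    have h5 : (⟪g, R w₀⟫_ℂ).re < c * ‖R w₀‖ ^ 2 := by
      have h6 : w₀ - (c : ℂ) • R w₀ - V (R w₀) = g - (c : ℂ) • R w₀ := by rw [hg]; abel
      rw [h6, inner_sub_left, inner_smul_left, Complex.conj_ofReal, Complex.sub_re,
        Complex.re_ofReal_mul, hself] at hneg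
      linarith
    have h7 : c ^ 2 * (⟪B (R w₀), R w₀⟫_ℂ).re ≤ c * ‖R w₀‖ ^ 2 := by
      calc _ ≤ c ^ 2 * (c⁻¹ * ‖R w₀‖ ^ 2) := by gcongr
        _ = _ := by field_simp
    linarith
  obtain ⟨μ, hμ, u, huM, hu0, hBu⟩ := exists_eigenvector_of_lt_rayleigh B R (B * (V * R)) hBsym
    (Submodule.span ℂ S)ᗮ (Submodule.isClosed_orthogonal _) hBperp c⁻¹ hBRK hRle hKB hw₀ hbv
  have hμ0 : 0 < μ := lt_trans (by positivity) hμ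
  refine ⟨μ⁻¹ - c, ?_, u, huM, hu0, (μ : ℂ)⁻¹ • (↑N⁻¹ : H →L[ℂ] H) u, ?_, ?_⟩
  · rw [sub_neg]; exact inv_lt_of_inv_lt₀ hc hμ
  · rw [map_smul, ← hBa, hBu, smul_smul, inv_mul_cancel₀ (by exact_mod_cast hμ0.ne'), one_smul]
  · have h1 : V u = (μ : ℂ)⁻¹ • V (R ((↑N⁻¹ : H →L[ℂ] H) u)) := by
      rw [← hBa, hBu, map_smul, smul_smul, inv_mul_cancel₀ (by exact_mod_cast hμ0.ne'), one_smul]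
    have h3 : (μ : ℂ)⁻¹ • u = (μ : ℂ)⁻¹ • (↑N⁻¹ : H →L[ℂ] H) u -
        (μ : ℂ)⁻¹ • V (R ((↑N⁻¹ : H →L[ℂ] H) u)) := by rw [← smul_sub, hN2]
    rw [h1]
    push_cast
    rw [sub_smul, h3]
    abel

end AbstractSpectral

/-! ### Multiplication operators, Fourier multipliers and the free resolvent. -/

section Multipliers

open scoped InnerProductSpace BoundedContinuousFunction

variable {d : ℕ}

theorem memLp_bcf_mul (g : EuclideanSpace ℝ (Fin d) →ᵇ ℝ) (u : L2Space d) :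
    MemLp (fun x => (g x : ℂ) * u x) 2 volume := by
  refine MemLp.of_le_mul (c := ‖g‖) (Lp.memLp u) ?_ (Filter.Eventually.of_forall fun x => ?_)
  · exact (Complex.continuous_ofReal.comp g.continuous).aestronglyMeasurable.mul
      (Lp.aestronglyMeasurable u)
  · rw [norm_mul, Complex.norm_real]
    gcongr
    exact g.norm_coe_le_norm x

/-- Multiplication by a bounded continuous real function, as a bounded operator on `L²`. -/
noncomputable def bcfMul (g : EuclideanSpace ℝ (Fin d) →ᵇ ℝ) : L2Space d →L[ℂ] L2Space d :=
  LinearMap.mkContinuous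
    { toFun := fun u => (memLp_bcf_mul g u).toLp _
      map_add' := fun u v => by
        apply Lp.ext
        filter_upwards [Lp.coeFn_add u v, (memLp_bcf_mul g (u + v)).coeFn_toLp,
          (memLp_bcf_mul g u).coeFn_toLp, (memLp_bcf_mul g v).coeFn_toLp,
          Lp.coeFn_add ((memLp_bcf_mul g u).toLp _) ((memLp_bcf_mul g v).toLp _)]
          with x h1 h2 h3 h4 h5
        rw [h2, h5, Pi.add_apply, h3, h4, h1, Pi.add_apply, mul_add]
      map_smul' := fun a u => by
        apply Lp.ext
        filter_upwards [Lp.coeFn_smul a u, (memLp_bcf_mul g (a • u)).coeFn_toLp,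
          (memLp_bcf_mul g u).coeFn_toLp, Lp.coeFn_smul a ((memLp_bcf_mul g u).toLp _)]
          with x h1 h2 h3 h4
        rw [h2, RingHom.id_apply, h4, Pi.smul_apply, h3, h1, Pi.smul_apply, smul_eq_mul,
          smul_eq_mul, mul_left_comm] }
    ‖g‖ fun u => by
      apply Lp.norm_le_mul_norm_of_ae_le_mul
      filter_upwards [(memLp_bcf_mul g u).coeFn_toLp] with x hx
      simp only [LinearMap.coe_mk, AddHom.coe_mk]
      rw [hx, norm_mul, Complex.norm_real]
      gcongr
      exact g.norm_coe_le_norm x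

theorem coeFn_bcfMul (g : EuclideanSpace ℝ (Fin d) →ᵇ ℝ) (u : L2Space d) :
    bcfMul g u =ᵐ[volume] fun x => (g x : ℂ) * u x :=
  (memLp_bcf_mul g u).coeFn_toLp

theorem norm_bcfMul_le (g : EuclideanSpace ℝ (Fin d) →ᵇ ℝ) :
    ‖(bcfMul g : L2Space d →L[ℂ] L2Space d)‖ ≤ ‖g‖ :=
  LinearMap.mkContinuous_norm_le _ (norm_nonneg _) _

theorem bcfMul_mul (g h : EuclideanSpace ℝ (Fin d) →ᵇ ℝ) (u : L2Space d) :
    bcfMul (g * h) u = bcfMul g (bcfMul h u) := by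
  apply Lp.ext
  filter_upwards [coeFn_bcfMul (g * h) u, coeFn_bcfMul g (bcfMul h u), coeFn_bcfMul h u]
    with x h1 h2 h3
  rw [h1, h2, h3, BoundedContinuousFunction.mul_apply]
  push_cast; ring

theorem inner_bcfMul_left (g : EuclideanSpace ℝ (Fin d) →ᵇ ℝ) (u v : L2Space d) :
    ⟪bcfMul g u, v⟫_ℂ = ⟪u, bcfMul g v⟫_ℂ := by
  rw [L2.inner_def, L2.inner_def]
  apply integral_congr_ae
  filter_upwards [coeFn_bcfMul g u, coeFn_bcfMul g v] with x h1 h2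
  rw [h1, h2]
  simp only [RCLike.inner_apply, map_mul, Complex.conj_ofReal]
  ring

theorem re_inner_bcfMul (g : EuclideanSpace ℝ (Fin d) →ᵇ ℝ) (u : L2Space d) :
    (⟪bcfMul g u, u⟫_ℂ).re = ∫ x, g x * ‖u x‖ ^ 2 := by
  rw [L2.inner_def]
  have h : (∫ x, ⟪bcfMul g u x, u x⟫_ℂ) = ((∫ x, g x * ‖u x‖ ^ 2 : ℝ) : ℂ) := by
    rw [← integral_complex_ofReal]
    apply integral_congr_ae
    filter_upwards [coeFn_bcfMul g u] with x h1
    rw [h1]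
    simp only [RCLike.inner_apply, map_mul, Complex.conj_ofReal]
    rw [mul_left_comm, Complex.mul_conj, Complex.normSq_eq_norm_sq]
    push_cast; ring
  rw [h, Complex.ofReal_re]

theorem integrable_bcf_mul_norm_sq (g : EuclideanSpace ℝ (Fin d) →ᵇ ℝ) (u : L2Space d) :
    Integrable (fun x => g x * ‖u x‖ ^ 2) := by
  have h := (Lp.memLp u).integrable_norm_pow (p := 2) (by norm_num)
  refine Integrable.bdd_mul (c := ‖g‖) h g.continuous.aestronglyMeasurable
    (Filter.Eventually.of_forall fun x => g.norm_coe_le_norm x)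

theorem re_inner_bcfMul_mono {g h : EuclideanSpace ℝ (Fin d) →ᵇ ℝ} (hgh : ∀ x, g x ≤ h x)
    (u : L2Space d) : (⟪bcfMul g u, u⟫_ℂ).re ≤ (⟪bcfMul h u, u⟫_ℂ).re := by
  rw [re_inner_bcfMul, re_inner_bcfMul]
  refine integral_mono (integrable_bcf_mul_norm_sq g u) (integrable_bcf_mul_norm_sq h u)
    fun x => ?_
  have := hgh x
  dsimp only
  gcongr

/-- The Fourier multiplier with symbol `g`. -/
noncomputable def fourierMul (g : EuclideanSpace ℝ (Fin d) →ᵇ ℝ) : L2Space d →L[ℂ] L2Space d :=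
  let F := Lp.fourierTransformₗᵢ (EuclideanSpace ℝ (Fin d)) ℂ
  (F.symm.toContinuousLinearEquiv : L2Space d →L[ℂ] L2Space d) ∘L bcfMul g ∘L
    (F.toContinuousLinearEquiv : L2Space d →L[ℂ] L2Space d)

theorem fourierMul_apply (g : EuclideanSpace ℝ (Fin d) →ᵇ ℝ) (u : L2Space d) :
    fourierMul g u = (Lp.fourierTransformₗᵢ (EuclideanSpace ℝ (Fin d)) ℂ).symm
      (bcfMul g (Lp.fourierTransformₗᵢ (EuclideanSpace ℝ (Fin d)) ℂ u)) := rfl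

theorem fourier_fourierMul (g : EuclideanSpace ℝ (Fin d) →ᵇ ℝ) (u : L2Space d) :
    Lp.fourierTransformₗᵢ (EuclideanSpace ℝ (Fin d)) ℂ (fourierMul g u) =
      bcfMul g (Lp.fourierTransformₗᵢ (EuclideanSpace ℝ (Fin d)) ℂ u) := by
  rw [fourierMul_apply, LinearIsometryEquiv.apply_symm_apply]

theorem inner_fourierMul (g : EuclideanSpace ℝ (Fin d) →ᵇ ℝ) (u v : L2Space d) :
    ⟪fourierMul g u, v⟫_ℂ = ⟪bcfMul g (Lp.fourierTransformₗᵢ (EuclideanSpace ℝ (Fin d)) ℂ u),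
      Lp.fourierTransformₗᵢ (EuclideanSpace ℝ (Fin d)) ℂ v⟫_ℂ := by
  rw [← fourier_fourierMul, LinearIsometryEquiv.inner_map_map]

theorem inner_fourierMul_left (g : EuclideanSpace ℝ (Fin d) →ᵇ ℝ) (u v : L2Space d) :
    ⟪fourierMul g u, v⟫_ℂ = ⟪u, fourierMul g v⟫_ℂ := by
  rw [inner_fourierMul, inner_bcfMul_left, ← fourier_fourierMul, LinearIsometryEquiv.inner_map_map]

theorem norm_fourierMul_le (g : EuclideanSpace ℝ (Fin d) →ᵇ ℝ) :
    ‖(fourierMul g : L2Space d →L[ℂ] L2Space d)‖ ≤ ‖g‖ := by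
  refine ContinuousLinearMap.opNorm_le_bound _ (norm_nonneg _) fun u => ?_
  rw [fourierMul_apply, LinearIsometryEquiv.norm_map]
  refine ((bcfMul g).le_of_opNorm_le (norm_bcfMul_le g) _).trans ?_
  rw [LinearIsometryEquiv.norm_map]

theorem norm_sq_bcfMul (g : EuclideanSpace ℝ (Fin d) →ᵇ ℝ) (u : L2Space d) :
    ‖bcfMul g u‖ ^ 2 = (⟪bcfMul (g * g) u, u⟫_ℂ).re := by
  rw [bcfMul_mul, inner_bcfMul_left, inner_self_eq_norm_sq_to_K]; norm_cast

/-- The symbol `((2π|ξ|)^{2s} + e)⁻¹` of the free resolvent at `-e`. -/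
noncomputable def resolventSymbol (d : ℕ) {s e : ℝ} (hs : 0 ≤ s) (he : 0 < e) :
    EuclideanSpace ℝ (Fin d) →ᵇ ℝ :=
  BoundedContinuousFunction.ofNormedAddCommGroup
    (fun ξ => ((2 * Real.pi * ‖ξ‖) ^ (2 * s) + e)⁻¹)
    (by
      have h : Continuous fun ξ : EuclideanSpace ℝ (Fin d) => (2 * Real.pi * ‖ξ‖) ^ (2 * s) :=
        (continuous_const.mul continuous_norm).rpow_const fun _ => Or.inr (by positivity)
      exact (h.add continuous_const).inv₀ fun ξ =>
        (show 0 < (2 * Real.pi * ‖ξ‖) ^ (2 * s) + e by positivity).ne')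
    e⁻¹ fun ξ => by
      rw [Real.norm_of_nonneg (by positivity)]
      gcongr
      simp only [le_add_iff_nonneg_left]
      positivity

theorem resolventSymbol_apply {s e : ℝ} (hs : 0 ≤ s) (he : 0 < e)
    (ξ : EuclideanSpace ℝ (Fin d)) :
    resolventSymbol d hs he ξ = ((2 * Real.pi * ‖ξ‖) ^ (2 * s) + e)⁻¹ := rfl

theorem norm_resolventSymbol_le {s e : ℝ} (hs : 0 ≤ s) (he : 0 < e) :
    ‖resolventSymbol d hs he‖ ≤ e⁻¹ :=
  BoundedContinuousFunction.norm_ofNormedAddCommGroup_le _ (by positivity) _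

theorem resolventSymbol_nonneg {s e : ℝ} (hs : 0 ≤ s) (he : 0 < e)
    (ξ : EuclideanSpace ℝ (Fin d)) : 0 ≤ resolventSymbol d hs he ξ := by
  rw [resolventSymbol_apply]; positivity

theorem symbol_mul_resolventSymbol {s e : ℝ} (hs : 0 ≤ s) (he : 0 < e)
    (ξ : EuclideanSpace ℝ (Fin d)) :
    ((2 * Real.pi * ‖ξ‖) ^ (2 * s) + e) * resolventSymbol d hs he ξ = 1 :=
  mul_inv_cancel₀ (by positivity)

/-- On the Fourier side the symbol `g` satisfies `e g ≤ 1`, hence `e g² ≤ g` pointwise. -/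
theorem resolvent_coercive {s e : ℝ} (hs : 0 ≤ s) (he : 0 < e) (u : L2Space d) :
    e * ‖fourierMul (resolventSymbol d hs he) u‖ ^ 2 ≤
      (⟪fourierMul (resolventSymbol d hs he) u, u⟫_ℂ).re := by
  rw [inner_fourierMul, fourierMul_apply, LinearIsometryEquiv.norm_map, norm_sq_bcfMul,
    re_inner_bcfMul, re_inner_bcfMul, ← integral_const_mul]
  refine integral_mono ((integrable_bcf_mul_norm_sq _ _).const_mul _)
    (integrable_bcf_mul_norm_sq _ _) fun ξ => ?_
  dsimp only
  rw [← mul_assoc, BoundedContinuousFunction.mul_apply]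
  gcongr
  have h0 := resolventSymbol_nonneg hs he ξ
  have h1 := symbol_mul_resolventSymbol hs he ξ
  have h2 : e * resolventSymbol d hs he ξ ≤ 1 := by
    rw [← h1]; gcongr; simp only [le_add_iff_nonneg_left]; positivity
  nlinarith

/-- Comparison of the free resolvents at `-e` and `-c`. -/
theorem resolvent_eq_resolvent {s e c : ℝ} (hs : 0 ≤ s) (he : 0 < e) (hc : 0 < c)
    (u : L2Space d) :
    fourierMul (resolventSymbol d hs he) u = fourierMul (resolventSymbol d hs hc)
      (u + ((c - e : ℝ) : ℂ) • fourierMul (resolventSymbol d hs he) u) := by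
  apply (Lp.fourierTransformₗᵢ (EuclideanSpace ℝ (Fin d)) ℂ).injective
  rw [fourier_fourierMul, fourier_fourierMul, map_add, map_smul, fourier_fourierMul]
  set v := Lp.fourierTransformₗᵢ (EuclideanSpace ℝ (Fin d)) ℂ u
  apply Lp.ext
  filter_upwards [coeFn_bcfMul (resolventSymbol d hs he) v,
    coeFn_bcfMul (resolventSymbol d hs hc)
      (v + ((c - e : ℝ) : ℂ) • bcfMul (resolventSymbol d hs he) v),
    Lp.coeFn_add v (((c - e : ℝ) : ℂ) • bcfMul (resolventSymbol d hs he) v),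
    Lp.coeFn_smul ((c - e : ℝ) : ℂ) (bcfMul (resolventSymbol d hs he) v)] with ξ h1 h2 h3 h4
  rw [h2, h3, Pi.add_apply, h4, Pi.smul_apply, h1, smul_eq_mul]
  have h5 := symbol_mul_resolventSymbol hs he ξ
  have h6 := symbol_mul_resolventSymbol hs hc ξ
  set m := (2 * Real.pi * ‖ξ‖) ^ (2 * s)
  set a := resolventSymbol d hs he ξ
  set b := resolventSymbol d hs hc ξ
  have h7 : a = b * (1 + (c - e) * a) := by
    linear_combination b * h5 - a * h6
  have h8 : (a : ℂ) = b * (1 + (c - e) * a) := by exact_mod_cast h7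
  push_cast
  linear_combination (v ξ) * h8

theorem exists_resolvent_eq_of_mem_domain {s c : ℝ} (hs : 0 ≤ s) (hc : 0 < c)
    (u : (fracLaplacian d s).domain) :
    fourierMul (resolventSymbol d hs hc) (fracLaplacian d s u + (c : ℂ) • (u : L2Space d)) = u := by
  apply (Lp.fourierTransformₗᵢ (EuclideanSpace ℝ (Fin d)) ℂ).injective
  have hu : MemLp (fun ξ => (((2 * Real.pi * ‖ξ‖) ^ (2 * s) : ℝ) : ℂ) *
    (Lp.fourierTransformₗᵢ (EuclideanSpace ℝ (Fin d)) ℂ (u : L2Space d)) ξ) 2 volume := u.2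
  have h0 : Lp.fourierTransformₗᵢ (EuclideanSpace ℝ (Fin d)) ℂ (fracLaplacian d s u) =
      hu.toLp _ :=
    (Lp.fourierTransformₗᵢ (EuclideanSpace ℝ (Fin d)) ℂ).apply_symm_apply _
  rw [fourier_fourierMul, map_add, map_smul, h0]
  set v := Lp.fourierTransformₗᵢ (EuclideanSpace ℝ (Fin d)) ℂ (u : L2Space d)
  apply Lp.ext
  filter_upwards [coeFn_bcfMul (resolventSymbol d hs hc) (hu.toLp _ + (c : ℂ) • v),
    Lp.coeFn_add (hu.toLp _) ((c : ℂ) • v), Lp.coeFn_smul (c : ℂ) v, hu.coeFn_toLp]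
    with ξ h1 h2 h3 h4
  rw [h1, h2, Pi.add_apply, h3, h4, Pi.smul_apply, smul_eq_mul]
  have h6 : (((2 * Real.pi * ‖ξ‖) ^ (2 * s) : ℝ) + (c : ℂ)) * resolventSymbol d hs hc ξ = 1 := by
    exact_mod_cast symbol_mul_resolventSymbol hs hc ξ
  linear_combination (v ξ) * h6

/-- Together with `exists_resolvent_eq_of_mem_domain` this identifies the domain of `(-Δ)^s` with
the range of the free resolvent, so that the unbounded eigenvalue equation can be handled through
bounded operators. -/
theorem exists_domain_eq_resolvent {s c : ℝ} (hs : 0 ≤ s) (hc : 0 < c) (w : L2Space d) :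
    ∃ h : fourierMul (resolventSymbol d hs hc) w ∈ (fracLaplacian d s).domain,
      fracLaplacian d s ⟨_, h⟩ = w - (c : ℂ) • fourierMul (resolventSymbol d hs hc) w := by
  set F := Lp.fourierTransformₗᵢ (EuclideanSpace ℝ (Fin d)) ℂ with hF
  have key : (fun ξ => (((2 * Real.pi * ‖ξ‖) ^ (2 * s) : ℝ) : ℂ) *
      (F (fourierMul (resolventSymbol d hs hc) w)) ξ) =ᵐ[volume]
      (F (w - (c : ℂ) • fourierMul (resolventSymbol d hs hc) w) : L2Space d) := by
    rw [map_sub, map_smul, hF, fourier_fourierMul, ← hF]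
    set v := F w
    filter_upwards [coeFn_bcfMul (resolventSymbol d hs hc) v,
      Lp.coeFn_sub v ((c : ℂ) • bcfMul (resolventSymbol d hs hc) v),
      Lp.coeFn_smul (c : ℂ) (bcfMul (resolventSymbol d hs hc) v)] with ξ h1 h2 h3
    rw [h2, Pi.sub_apply, h3, Pi.smul_apply, h1, smul_eq_mul]
    have h6 : (((2 * Real.pi * ‖ξ‖) ^ (2 * s) : ℝ) + (c : ℂ)) *
        resolventSymbol d hs hc ξ = 1 := by
      exact_mod_cast symbol_mul_resolventSymbol hs hc ξ
    linear_combination (v ξ) * h6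
  have hmem : MemLp (fun ξ => (((2 * Real.pi * ‖ξ‖) ^ (2 * s) : ℝ) : ℂ) *
      (F (fourierMul (resolventSymbol d hs hc) w)) ξ) 2 volume :=
    (Lp.memLp (F (w - (c : ℂ) • fourierMul (resolventSymbol d hs hc) w))).ae_eq key.symm
  refine ⟨hmem, F.injective ?_⟩
  have h0 : F (fracLaplacian d s ⟨_, hmem⟩) = hmem.toLp _ := F.apply_symm_apply _
  rw [h0]
  exact Lp.ext (hmem.coeFn_toLp.trans key)

theorem mem_mulDomain_bcf (g : EuclideanSpace ℝ (Fin d) →ᵇ ℝ) (u : L2Space d) :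
    u ∈ (mulOp d g).domain := memLp_bcf_mul g u

theorem mulOp_bcf_apply (g : EuclideanSpace ℝ (Fin d) →ᵇ ℝ) (u : (mulOp d g).domain) :
    mulOp d g u = bcfMul g (u : L2Space d) := rfl

theorem fracSchrodinger_apply {s : ℝ} {V : EuclideanSpace ℝ (Fin d) → ℝ} {u : L2Space d}
    (h : u ∈ (fracSchrodinger d s V).domain) (h₁ : u ∈ (fracLaplacian d s).domain)
    (h₂ : u ∈ (mulOp d V).domain) :
    fracSchrodinger d s V ⟨u, h⟩ = fracLaplacian d s ⟨u, h₁⟩ - mulOp d V ⟨u, h₂⟩ :=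
  LinearPMap.sub_apply (fracLaplacian d s) (mulOp d V) ⟨u, h⟩

/-- Elements of the domain of `(-Δ)^s - V` in terms of the free resolvent. -/
theorem fracSchrodinger_exists_resolvent {s c : ℝ} (hs : 0 ≤ s) (hc : 0 < c)
    (V : EuclideanSpace ℝ (Fin d) →ᵇ ℝ) (x : (fracSchrodinger d s V).domain) :
    ∃ w, fourierMul (resolventSymbol d hs hc) w = x ∧
      fracSchrodinger d s V x = w - (c : ℂ) • (x : L2Space d) - bcfMul V x := by
  obtain ⟨u, hu⟩ := x
  have h₁ : u ∈ (fracLaplacian d s).domain := hu.1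
  refine ⟨fracLaplacian d s ⟨u, h₁⟩ + (c : ℂ) • u,
    exists_resolvent_eq_of_mem_domain hs hc ⟨u, h₁⟩, ?_⟩
  rw [fracSchrodinger_apply hu h₁ (mem_mulDomain_bcf V u), mulOp_bcf_apply, add_sub_cancel_right]

theorem fracSchrodinger_resolvent {s c : ℝ} (hs : 0 ≤ s) (hc : 0 < c)
    (V : EuclideanSpace ℝ (Fin d) →ᵇ ℝ) (w : L2Space d) :
    ∃ x : (fracSchrodinger d s V).domain, (x : L2Space d) = fourierMul (resolventSymbol d hs hc) w ∧
      fracSchrodinger d s V x = w - (c : ℂ) • (x : L2Space d) - bcfMul V x := by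
  obtain ⟨h₁, hw⟩ := exists_domain_eq_resolvent (d := d) hs hc w
  have h₂ := mem_mulDomain_bcf V (fourierMul (resolventSymbol d hs hc) w)
  have h : fourierMul (resolventSymbol d hs hc) w ∈ (fracSchrodinger d s V).domain := ⟨h₁, h₂⟩
  refine ⟨⟨_, h⟩, rfl, ?_⟩
  rw [fracSchrodinger_apply h h₁ h₂, mulOp_bcf_apply, hw]

end Multipliers

/-! ### Compactness of `V` relative to `(-Δ)^s`. -/

section RelativeCompactness

open Filter Topology
open scoped InnerProductSpace BoundedContinuousFunction

/-- Sequential Banach–Alaoglu in the dual, transported through the Riesz isometry; a final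
conjugation moves the sequence to the second slot. -/
theorem exists_weakly_convergent_subseq {H : Type*} [NormedAddCommGroup H]
    [InnerProductSpace ℂ H] [CompleteSpace H] [TopologicalSpace.SeparableSpace H]
    (u : ℕ → H) {C : ℝ} (hu : ∀ n, ‖u n‖ ≤ C) :
    ∃ φ : ℕ → ℕ, StrictMono φ ∧ ∃ v : H, ∀ y, Tendsto (fun n => ⟪y, u (φ n)⟫_ℂ) atTop
      (𝓝 ⟪y, v⟫_ℂ) := by
  have hb : ∀ n, StrongDual.toWeakDual (InnerProductSpace.toDual ℂ H (u n)) ∈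
      WeakDual.toStrongDual ⁻¹' Metric.closedBall (0 : StrongDual ℂ H) C := fun n => by
    show InnerProductSpace.toDual ℂ H (u n) ∈ Metric.closedBall (0 : StrongDual ℂ H) C
    rw [mem_closedBall_zero_iff, LinearIsometryEquiv.norm_map]
    exact hu n
  obtain ⟨Λ, -, φ, hφ, hΛ⟩ := WeakDual.isSeqCompact_closedBall ℂ H 0 C hb
  refine ⟨φ, hφ, (InnerProductSpace.toDual ℂ H).symm (WeakDual.toStrongDual Λ), fun y => ?_⟩
  have h1 : Tendsto (fun n => ⟪u (φ n), y⟫_ℂ) atTop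
      (𝓝 ⟪(InnerProductSpace.toDual ℂ H).symm (WeakDual.toStrongDual Λ), y⟫_ℂ) := by
    rw [InnerProductSpace.toDual_symm_apply]
    exact ((WeakDual.eval_continuous y).tendsto Λ).comp hΛ
  have h2 := (Complex.continuous_conj.tendsto _).comp h1
  rw [inner_conj_symm] at h2
  exact h2.congr fun n => inner_conj_symm _ _

variable {d : ℕ}

theorem continuous_fourierInv_of_integrable {h : EuclideanSpace ℝ (Fin d) → ℂ}
    (hh : Integrable h) : Continuous (𝓕⁻ h) :=
  VectorFourier.fourierIntegral_continuous Real.continuous_fourierChar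
    (by simp only [LinearMap.neg_apply, innerₗ_apply_apply]; fun_prop) hh

theorem integral_fourierInv_smul_eq {f h : EuclideanSpace ℝ (Fin d) → ℂ}
    (hf : Integrable f) (hh : Integrable h) : ∫ x, 𝓕⁻ f x • h x = ∫ x, f x • 𝓕⁻ h x := by
  have := VectorFourier.integral_fourierIntegral_smul_eq_flip (μ := volume) (ν := volume)
    (L := -innerₗ (EuclideanSpace ℝ (Fin d))) Real.continuous_fourierChar
    (by simp only [LinearMap.neg_apply, innerₗ_apply_apply]; fun_prop) hf hh
  have h2 : (-innerₗ (EuclideanSpace ℝ (Fin d))).flip = -innerₗ (EuclideanSpace ℝ (Fin d)) := by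
    ext x y; simp [real_inner_comm]
  rw [h2] at this
  exact this

/-- On `L¹ ∩ L²` the inverse `L²` Fourier transform is given by the Fourier integral. -/
theorem coeFn_fourier_symm (h : L2Space d) (hh : Integrable h) :
    (Lp.fourierTransformₗᵢ (EuclideanSpace ℝ (Fin d)) ℂ).symm h =ᵐ[volume] 𝓕⁻ (h : _ → ℂ) := by
  refine ae_eq_of_integral_contDiff_smul_eq ?_ ?_ fun g hg hgc => ?_
  · exact (Lp.memLp _).locallyIntegrable (by norm_num)
  · exact (continuous_fourierInv_of_integrable hh).locallyIntegrable
  · have hg₁ : HasCompactSupport (Complex.ofRealCLM ∘ g) := hgc.comp_left rfl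
    have hg₂ : ContDiff ℝ ∞ (Complex.ofRealCLM ∘ g) := by fun_prop
    set G := hg₁.toSchwartzMap hg₂
    have hGa : ∀ x, G x = (g x : ℂ) := fun x => rfl
    have h1 : (Lp.toTemperedDistribution (𝓕⁻ h : L2Space d)) G =
        Lp.toTemperedDistribution h (𝓕⁻ G) := by
      rw [← Lp.fourierInv_toTemperedDistribution_eq]; rfl
    rw [Lp.toTemperedDistribution_apply, Lp.toTemperedDistribution_apply] at h1
    have h2 : ∫ x, (𝓕⁻ G) x • h x = ∫ x, G x • 𝓕⁻ (h : _ → ℂ) x := by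
      rw [SchwartzMap.fourierInv_coe]
      exact integral_fourierInv_smul_eq G.integrable hh
    rw [h2] at h1
    exact h1

theorem resolventSymbol_le {s e : ℝ} (hs : 0 ≤ s) (he : 0 < e) (ξ : EuclideanSpace ℝ (Fin d)) :
    resolventSymbol d hs he ξ ≤ 2 ^ (2 * s) * (1 + e⁻¹) * (1 + ‖ξ‖) ^ (-(2 * s)) := by
  set t := ‖ξ‖
  have ht : 0 ≤ t := norm_nonneg ξ
  rw [resolventSymbol_apply, Real.rpow_neg (by positivity), ← div_eq_mul_inv,
    le_div_iff₀ (by positivity), inv_mul_le_iff₀ (by positivity)]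
  have h1 : (1 + t) ^ (2 * s) ≤ 2 ^ (2 * s) * (1 + t ^ (2 * s)) := by
    rcases le_total t 1 with h | h
    · calc (1 + t) ^ (2 * s) ≤ 2 ^ (2 * s) := by gcongr; linarith
        _ ≤ 2 ^ (2 * s) * (1 + t ^ (2 * s)) := by
          refine le_mul_of_one_le_right (by positivity) ?_
          simp only [le_add_iff_nonneg_right]; positivity
    · calc (1 + t) ^ (2 * s) ≤ (2 * t) ^ (2 * s) := by gcongr; linarith
        _ = 2 ^ (2 * s) * t ^ (2 * s) := Real.mul_rpow (by norm_num) ht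
        _ ≤ _ := by gcongr; linarith
  have h2 : t ^ (2 * s) ≤ (2 * Real.pi * t) ^ (2 * s) := by
    gcongr
    have := Real.pi_gt_three
    nlinarith
  have h3 : 1 + t ^ (2 * s) ≤ ((2 * Real.pi * t) ^ (2 * s) + e) * (1 + e⁻¹) := by
    have : ((2 * Real.pi * t) ^ (2 * s) + e) * (1 + e⁻¹) =
      (2 * Real.pi * t) ^ (2 * s) + (2 * Real.pi * t) ^ (2 * s) * e⁻¹ + e + 1 := by
      field_simp; ring
    rw [this]
    have : 0 ≤ (2 * Real.pi * t) ^ (2 * s) * e⁻¹ := by positivity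
    linarith
  calc (1 + t) ^ (2 * s) ≤ 2 ^ (2 * s) * (1 + t ^ (2 * s)) := h1
    _ ≤ 2 ^ (2 * s) * (((2 * Real.pi * t) ^ (2 * s) + e) * (1 + e⁻¹)) := by gcongr
    _ = _ := by ring

/-- The squared symbol decays like `|ξ|^{-4s}`, and `4s ≥ 2d > d`. This includes the endpoint `s =
d/2`. -/
theorem memLp_resolventSymbol {s e : ℝ} (hd : 1 ≤ d) (hs : (d : ℝ) / 2 ≤ s) (hs0 : 0 ≤ s)
    (he : 0 < e) : MemLp (resolventSymbol d hs0 he) 2 volume := by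
  rw [memLp_two_iff_integrable_sq (resolventSymbol d hs0 he).continuous.aestronglyMeasurable]
  have hd' : (1 : ℝ) ≤ d := by exact_mod_cast hd
  have h1 : Integrable (fun ξ : EuclideanSpace ℝ (Fin d) => (1 + ‖ξ‖) ^ (-(4 * s))) := by
    apply integrable_one_add_norm
    rw [finrank_euclideanSpace_fin]; linarith
  refine (h1.const_mul ((2 ^ (2 * s) * (1 + e⁻¹)) ^ 2)).mono'
    ((resolventSymbol d hs0 he).continuous.pow 2).aestronglyMeasurable
    (Eventually.of_forall fun ξ => ?_)
  have h2 := resolventSymbol_le hs0 he ξ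
  have h3 := resolventSymbol_nonneg hs0 he ξ
  have h4 : (1 + ‖ξ‖) ^ (-(4 * s)) = ((1 + ‖ξ‖) ^ (-(2 * s))) ^ 2 := by
    rw [← Real.rpow_mul_natCast (by positivity)]; congr 1; push_cast; ring
  rw [Real.norm_of_nonneg (by positivity), h4, ← mul_pow]
  gcongr

/-- The function `ξ ↦ e^{-2πi x·ξ} g(ξ)`. -/
theorem memLp_char_mul {g : EuclideanSpace ℝ (Fin d) →ᵇ ℝ} (hg : MemLp g 2 volume)
    (x : EuclideanSpace ℝ (Fin d)) :
    MemLp (fun ξ => (Real.fourierChar (-⟪ξ, x⟫_ℝ) : ℂ) * (g ξ : ℂ)) 2 volume := by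
  refine MemLp.of_le hg ?_ (Eventually.of_forall fun ξ => ?_)
  · have : Continuous fun ξ : EuclideanSpace ℝ (Fin d) =>
        (Real.fourierChar (-⟪ξ, x⟫_ℝ) : ℂ) * (g ξ : ℂ) := by
      have := Real.continuous_fourierChar
      have := g.continuous
      fun_prop
    exact this.aestronglyMeasurable
  · rw [norm_mul, Circle.norm_coe, one_mul, Complex.norm_real]

theorem integrable_bcfMul {g : EuclideanSpace ℝ (Fin d) →ᵇ ℝ} (hg : MemLp g 2 volume)
    (v : L2Space d) : Integrable (bcfMul g v) := by
  have h1 : Integrable (fun ξ => (g ξ : ℂ) * v ξ) :=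
    MemLp.integrable_mul (p := 2) (q := 2) hg.ofReal (Lp.memLp v)
  exact h1.congr (coeFn_bcfMul g v).symm

/-- A Fourier multiplier with square integrable symbol is an integral operator. -/
theorem coeFn_fourierMul {g : EuclideanSpace ℝ (Fin d) →ᵇ ℝ} (hg : MemLp g 2 volume)
    (u : L2Space d) : fourierMul g u =ᵐ[volume] fun x => ⟪(memLp_char_mul hg x).toLp _,
      Lp.fourierTransformₗᵢ (EuclideanSpace ℝ (Fin d)) ℂ u⟫_ℂ := by
  set v := Lp.fourierTransformₗᵢ (EuclideanSpace ℝ (Fin d)) ℂ u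
  filter_upwards [coeFn_fourier_symm (bcfMul g v) (integrable_bcfMul hg v)] with x hx
  rw [fourierMul_apply, hx, Real.fourierInv_eq, L2.inner_def]
  apply integral_congr_ae
  filter_upwards [coeFn_bcfMul g v, (memLp_char_mul hg x).coeFn_toLp] with ξ h1 h2
  rw [h1, h2, RCLike.inner_apply, Circle.smul_def, map_mul, Complex.conj_ofReal,
    AddChar.map_neg_eq_inv, Circle.coe_inv_eq_conj, Complex.conj_conj, smul_eq_mul]
  ring

/-- `V g(D)` is compact if `g` and `V` are bounded and square integrable. -/
theorem exists_subseq_bcfMul_fourierMul_tendsto {g V : EuclideanSpace ℝ (Fin d) →ᵇ ℝ}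
    (hg : MemLp g 2 volume) (hV : MemLp V 2 volume) (u : ℕ → L2Space d) (hu : ∀ n, ‖u n‖ = 1) :
    ∃ φ : ℕ → ℕ, StrictMono φ ∧ ∃ y,
      Tendsto (fun n => bcfMul V (fourierMul g (u (φ n)))) atTop (𝓝 y) := by
  have : Fact ((2 : ENNReal) ≠ ⊤) := ⟨by norm_num⟩
  obtain ⟨φ, hφ, v, hv⟩ := exists_weakly_convergent_subseq u (fun n => (hu n).le)
  refine ⟨φ, hφ, bcfMul V (fourierMul g v), ?_⟩
  rw [tendsto_iff_norm_sub_tendsto_zero]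
  set F := Lp.fourierTransformₗᵢ (EuclideanSpace ℝ (Fin d)) ℂ with hF
  set k : EuclideanSpace ℝ (Fin d) → L2Space d := fun x => (memLp_char_mul hg x).toLp _
  have hk : ∀ x, ‖k x‖ ≤ ‖hg.toLp _‖ := fun x => by
    apply Lp.norm_le_norm_of_ae_le
    filter_upwards [(memLp_char_mul hg x).coeFn_toLp, hg.coeFn_toLp] with ξ h1 h2
    rw [h1, h2, norm_mul, Circle.norm_coe, one_mul, Complex.norm_real]
  set A := ‖hg.toLp _‖
  set w : ℕ → L2Space d := fun n => u (φ n) - v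
  have hw : ∀ n, ‖w n‖ ≤ 1 + ‖v‖ := fun n => (norm_sub_le _ _).trans (by rw [hu])
  have hw0 : ∀ y, Tendsto (fun n => ⟪y, w n⟫_ℂ) atTop (𝓝 0) := fun y => by
    have := (hv y).sub_const ⟪y, v⟫_ℂ
    rw [sub_self] at this
    exact this.congr fun n => (inner_sub_right _ _ _).symm
  -- Each value of `g(D) w` is an inner product with a fixed vector, so weak convergence becomes
  -- pointwise convergence; the kernel vectors `k x` have norms bounded uniformly in `x`, and
  -- dominated convergence with majorant a multiple of `V²` finishes.
  have hpt : ∀ x, Tendsto (fun n => ⟪k x, F (w n)⟫_ℂ) atTop (𝓝 0) := fun x => by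
    refine (hw0 (F.symm (k x))).congr fun n => ?_
    rw [← F.inner_map_map, F.apply_symm_apply]
  have hbd : ∀ n x, ‖⟪k x, F (w n)⟫_ℂ‖ ≤ A * (1 + ‖v‖) := fun n x => by
    refine (norm_inner_le_norm _ _).trans ?_
    rw [F.norm_map]
    gcongr
    exacts [hk x, hw n]
  have hnorm : ∀ n, ‖bcfMul V (fourierMul g (w n))‖ ^ 2 =
      ∫ x, V x ^ 2 * ‖⟪k x, F (w n)⟫_ℂ‖ ^ 2 := fun n => by
    rw [norm_sq_bcfMul, re_inner_bcfMul]
    apply integral_congr_ae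
    filter_upwards [coeFn_fourierMul hg (w n)] with x hx
    rw [hx, BoundedContinuousFunction.mul_apply, sq (V x)]
  have hint : Tendsto (fun n => ‖bcfMul V (fourierMul g (w n))‖ ^ 2) atTop (𝓝 0) := by
    simp only [hnorm]
    have hV2 := (memLp_two_iff_integrable_sq hV.1).mp hV
    have h0 : (0 : ℝ) = ∫ x : EuclideanSpace ℝ (Fin d), (0 : ℝ) := by simp
    rw [h0]
    refine tendsto_integral_of_dominated_convergence (fun x => V x ^ 2 * (A * (1 + ‖v‖)) ^ 2)
      (fun n => ?_) (hV2.mul_const _) (fun n => Eventually.of_forall fun x => ?_)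
      (Eventually.of_forall fun x => ?_)
    · have h1 : AEStronglyMeasurable (fun x => ⟪k x, F (w n)⟫_ℂ) volume :=
        (Lp.aestronglyMeasurable (fourierMul g (w n))).congr (coeFn_fourierMul hg (w n))
      exact hV2.1.mul (h1.norm.pow 2)
    · rw [Real.norm_of_nonneg (by positivity)]
      gcongr
      exact hbd n x
    · have := ((hpt x).norm.pow 2).const_mul (V x ^ 2)
      simpa using this
  have h2 := hint.sqrt
  simp only [Real.sqrt_zero, Real.sqrt_sq (norm_nonneg _)] at h2
  exact h2.congr fun n => by rw [map_sub, map_sub]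

end RelativeCompactness

/-! ### Moments and the singularity of `|ξ|^{-2s} |𝓕ψ|²` at the origin. -/

section LowFrequency

open Filter Topology
open scoped InnerProductSpace BoundedContinuousFunction

variable {d : ℕ}

theorem continuous_fourier_of_integrable {h : EuclideanSpace ℝ (Fin d) → ℂ}
    (hh : Integrable h) : Continuous (𝓕 h) :=
  VectorFourier.fourierIntegral_continuous Real.continuous_fourierChar
    (by simp only [innerₗ_apply_apply]; fun_prop) hh

theorem integral_fourier_smul_eq_of_integrable {f h : EuclideanSpace ℝ (Fin d) → ℂ}
    (hf : Integrable f) (hh : Integrable h) : ∫ x, 𝓕 f x • h x = ∫ x, f x • 𝓕 h x := by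
  have := VectorFourier.integral_fourierIntegral_smul_eq_flip (μ := volume) (ν := volume)
    (L := innerₗ (EuclideanSpace ℝ (Fin d))) Real.continuous_fourierChar
    (by simp only [innerₗ_apply_apply]; fun_prop) hf hh
  rw [flip_innerₗ] at this
  exact this

/-- On `L¹ ∩ L²` the `L²` Fourier transform is given by the Fourier integral. -/
theorem coeFn_fourier (h : L2Space d) (hh : Integrable h) :
    Lp.fourierTransformₗᵢ (EuclideanSpace ℝ (Fin d)) ℂ h =ᵐ[volume] 𝓕 (h : _ → ℂ) := by
  refine ae_eq_of_integral_contDiff_smul_eq ?_ ?_ fun g hg hgc => ?_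
  · exact (Lp.memLp _).locallyIntegrable (by norm_num)
  · exact (continuous_fourier_of_integrable hh).locallyIntegrable
  · have hg₁ : HasCompactSupport (Complex.ofRealCLM ∘ g) := hgc.comp_left rfl
    have hg₂ : ContDiff ℝ ∞ (Complex.ofRealCLM ∘ g) := by fun_prop
    set G := hg₁.toSchwartzMap hg₂
    have h1 : (Lp.toTemperedDistribution (𝓕 h : L2Space d)) G =
        Lp.toTemperedDistribution h (𝓕 G) := by
      rw [← Lp.fourier_toTemperedDistribution_eq]; rfl
    rw [Lp.toTemperedDistribution_apply, Lp.toTemperedDistribution_apply] at h1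
    have h2 : ∫ x, (𝓕 G) x • h x = ∫ x, G x • 𝓕 (h : _ → ℂ) x := by
      rw [SchwartzMap.fourier_coe]
      exact integral_fourier_smul_eq_of_integrable G.integrable hh
    rw [h2] at h1
    exact h1

theorem setLIntegral_ball_scale {f : EuclideanSpace ℝ (Fin d) → ℝ≥0∞} (hf : Measurable f)
    {r : ℝ} (hr : 0 < r) (ρ : ℝ) : ∫⁻ ξ in Metric.ball 0 (r * ρ), f ξ =
      ENNReal.ofReal (r ^ d) * ∫⁻ η in Metric.ball 0 ρ, f (r • η) := by
  have h1 : ∫⁻ η in Metric.ball (0 : EuclideanSpace ℝ (Fin d)) ρ, f (r • η) =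
      ∫⁻ ξ, (Metric.ball 0 (r * ρ)).indicator f ξ
        ∂(Measure.map (fun x : EuclideanSpace ℝ (Fin d) => r • x) volume) := by
    rw [lintegral_map (hf.indicator Metric.isOpen_ball.measurableSet) (measurable_const_smul r),
      ← lintegral_indicator Metric.isOpen_ball.measurableSet]
    congr 1
    ext η
    have : r • η ∈ Metric.ball (0 : EuclideanSpace ℝ (Fin d)) (r * ρ) ↔ η ∈ Metric.ball 0 ρ := by
      simp only [mem_ball_zero_iff, norm_smul, Real.norm_of_nonneg hr.le]
      exact mul_lt_mul_iff_right₀ hr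
    by_cases hη : η ∈ Metric.ball 0 ρ
    · rw [Set.indicator_of_mem hη, Set.indicator_of_mem (this.mpr hη)]
    · rw [Set.indicator_of_notMem hη, Set.indicator_of_notMem (fun h => hη (this.mp h))]
  rw [h1, Measure.map_addHaar_smul _ hr.ne', lintegral_smul_measure, smul_eq_mul, ← mul_assoc,
    finrank_euclideanSpace_fin, abs_of_nonneg (by positivity), ← ENNReal.ofReal_mul (by positivity),
    mul_inv_cancel₀ (by positivity), ENNReal.ofReal_one, one_mul,
    lintegral_indicator Metric.isOpen_ball.measurableSet]

theorem integrable_inner_pow_mul {ψ : EuclideanSpace ℝ (Fin d) → ℂ} (hψ : Integrable ψ)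
    {ρ : ℝ} (hρ : ∀ x, ρ < ‖x‖ → ψ x = 0) {f : EuclideanSpace ℝ (Fin d) → ℂ} (hf : Continuous f) :
    Integrable (fun x => f x * ψ x) := by
  obtain ⟨C, hC⟩ := (isCompact_closedBall (0 : EuclideanSpace ℝ (Fin d)) ρ).exists_bound_of_continuousOn
    hf.continuousOn
  refine (hψ.norm.const_mul C).mono' (hf.aestronglyMeasurable.mul hψ.1)
    (Eventually.of_forall fun x => ?_)
  rw [norm_mul]
  by_cases hx : ρ < ‖x‖
  · simp [hρ x hx]
  · gcongr
    exact hC x (mem_closedBall_zero_iff.mpr (not_lt.mp hx))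

/-- The `k`-th moment of `ψ` along `η`. -/
noncomputable def dirMoment (ψ : EuclideanSpace ℝ (Fin d) → ℂ) (k : ℕ)
    (η : EuclideanSpace ℝ (Fin d)) : ℂ :=
  ∫ x, ((⟪x, η⟫_ℝ : ℝ) : ℂ) ^ k * ψ x

/-- The mixed moments of `ψ`. -/
noncomputable def mixedMoment (ψ : EuclideanSpace ℝ (Fin d) → ℂ) (α : Fin d → ℕ) : ℂ :=
  ∫ x, ((∏ i, x i ^ α i : ℝ) : ℂ) * ψ x

/-- Multinomial expansion of `⟨x, η⟩^k`: a directional moment is a homogeneous polynomial in `η`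
whose coefficients are the mixed moments up to positive factors. -/
theorem dirMoment_eq_sum {ψ : EuclideanSpace ℝ (Fin d) → ℂ} (hψ : Integrable ψ)
    {ρ : ℝ} (hρ : ∀ x, ρ < ‖x‖ → ψ x = 0) (k : ℕ) (η : EuclideanSpace ℝ (Fin d)) :
    dirMoment ψ k η = ∑ α ∈ Finset.piAntidiag Finset.univ k,
      (Nat.multinomial Finset.univ α : ℂ) * mixedMoment ψ α * ∏ i, (η i : ℂ) ^ α i := by
  have h1 : ∀ x, ((⟪x, η⟫_ℝ : ℝ) : ℂ) ^ k * ψ x = ∑ α ∈ Finset.piAntidiag Finset.univ k,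
      ((Nat.multinomial Finset.univ α : ℂ) * ∏ i, (η i : ℂ) ^ α i) *
        (((∏ i, x i ^ α i : ℝ) : ℂ) * ψ x) := fun x => by
    have h2 : ((⟪x, η⟫_ℝ : ℝ) : ℂ) = ∑ i, (x i : ℂ) * (η i : ℂ) := by
      rw [PiLp.inner_apply]
      push_cast
      refine Finset.sum_congr rfl fun i _ => ?_
      simp [mul_comm]
    rw [h2, Finset.sum_pow_eq_sum_piAntidiag, Finset.sum_mul]
    refine Finset.sum_congr rfl fun α _ => ?_
    simp only [mul_pow, Finset.prod_mul_distrib]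
    push_cast
    ring
  unfold dirMoment mixedMoment
  simp only [h1]
  rw [integral_finsetSum]
  · refine Finset.sum_congr rfl fun α _ => ?_
    rw [integral_const_mul]; ring
  · intro α _
    exact (integrable_inner_pow_mul hψ hρ (by fun_prop)).const_mul _

theorem continuous_dirMoment {ψ : EuclideanSpace ℝ (Fin d) → ℂ} (hψ : Integrable ψ)
    {ρ : ℝ} (hρ : ∀ x, ρ < ‖x‖ → ψ x = 0) (k : ℕ) : Continuous (dirMoment ψ k) := by
  have : dirMoment ψ k = fun η => _ := funext (dirMoment_eq_sum hψ hρ k)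
  rw [this]
  fun_prop

/-- A complex polynomial vanishing at all real points is zero, so its coefficients can be read off.
-/
theorem mixedMoment_eq_zero_of_dirMoment {ψ : EuclideanSpace ℝ (Fin d) → ℂ} (hψ : Integrable ψ)
    {ρ : ℝ} (hρ : ∀ x, ρ < ‖x‖ → ψ x = 0) {k : ℕ} (hk : ∀ η, dirMoment ψ k η = 0)
    {α : Fin d → ℕ} (hα : ∑ i, α i = k) : mixedMoment ψ α = 0 := by
  set P : MvPolynomial (Fin d) ℂ := ∑ α ∈ Finset.piAntidiag Finset.univ k,
    MvPolynomial.monomial (Finsupp.equivFunOnFinite.symm α)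
      ((Nat.multinomial Finset.univ α : ℂ) * mixedMoment ψ α) with hP
  have hP0 : P = 0 := by
    refine MvPolynomial.funext_set (fun _ => Set.range Complex.ofReal)
      (fun _ => Set.infinite_range_of_injective Complex.ofReal_injective) fun x hx => ?_
    choose y hy using fun i => hx i (Set.mem_univ i)
    rw [map_zero, hP, map_sum, ← hk (WithLp.toLp 2 y), dirMoment_eq_sum hψ hρ]
    refine Finset.sum_congr rfl fun α _ => ?_
    rw [MvPolynomial.eval_monomial, Finsupp.prod_fintype _ _ (fun i => pow_zero _)]
    simp [hy]
  have hc := congrArg (MvPolynomial.coeff (Finsupp.equivFunOnFinite.symm α)) hP0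
  rw [hP, MvPolynomial.coeff_sum, Finset.sum_eq_single α] at hc
  · rw [MvPolynomial.coeff_monomial, if_pos rfl, MvPolynomial.coeff_zero] at hc
    refine (mul_eq_zero.mp hc).resolve_left ?_
    exact_mod_cast (Nat.multinomial_pos _ _).ne'
  · intro β _ hβ
    rw [MvPolynomial.coeff_monomial, if_neg]
    exact fun h => hβ (Finsupp.equivFunOnFinite.symm.injective h)
  · intro h
    exact absurd (by simp [hα]) h

/-- Taylor expansion of the Fourier transform along rays. -/
theorem norm_fourier_sub_le {ψ : EuclideanSpace ℝ (Fin d) → ℂ} (hψ : Integrable ψ)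
    {ρ : ℝ} (hρ : ∀ x, ρ < ‖x‖ → ψ x = 0) {j : ℕ} (hj : ∀ k < j, ∀ η, dirMoment ψ k η = 0)
    (η : EuclideanSpace ℝ (Fin d)) : ∃ K : ℝ, ∀ r : ℝ, 0 < r → r ≤ 1 →
      ‖𝓕 ψ (r • η) / (r : ℂ) ^ j - (-(2 * Real.pi * Complex.I)) ^ j / j.factorial *
        dirMoment ψ j η‖ ≤ r * K := by
  set z : EuclideanSpace ℝ (Fin d) → ℂ :=
    fun x => -(2 * Real.pi * Complex.I) * ((⟪x, η⟫_ℝ : ℝ) : ℂ) with hz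
  have hzc : Continuous z := by fun_prop
  have hKint : Integrable fun x => ‖z x‖ ^ (j + 1) * Real.exp ‖z x‖ * ‖ψ x‖ := by
    have := (integrable_inner_pow_mul hψ hρ (f := fun x =>
      ((‖z x‖ ^ (j + 1) * Real.exp ‖z x‖ : ℝ) : ℂ)) (by fun_prop)).norm
    refine this.congr (Eventually.of_forall fun x => ?_)
    dsimp only
    rw [norm_mul, Complex.norm_real, Real.norm_of_nonneg (by positivity)]
  refine ⟨∫ x, ‖z x‖ ^ (j + 1) * Real.exp ‖z x‖ * ‖ψ x‖, fun r hr hr1 => ?_⟩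
  have hrc : (r : ℂ) ≠ 0 := by exact_mod_cast hr.ne'
  have hF : 𝓕 ψ (r • η) = ∫ x, Complex.exp (r * z x) * ψ x := by
    rw [Real.fourier_eq']
    refine integral_congr_ae (Eventually.of_forall fun x => ?_)
    simp only [hz, inner_smul_right, smul_eq_mul]
    congr 2
    push_cast; ring
  have hint1 : Integrable fun x => Complex.exp (r * z x) * ψ x :=
    integrable_inner_pow_mul hψ hρ (by fun_prop)
  have hint2 : ∀ k, Integrable fun x => (r * z x) ^ k / (k.factorial : ℂ) * ψ x := fun k =>
    integrable_inner_pow_mul hψ hρ (by fun_prop)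
  have hterm : ∀ k, ∫ x, (r * z x) ^ k / (k.factorial : ℂ) * ψ x =
      (r : ℂ) ^ k * ((-(2 * Real.pi * Complex.I)) ^ k / k.factorial * dirMoment ψ k η) :=
    fun k => by
    rw [dirMoment, ← integral_const_mul, ← integral_const_mul]
    refine integral_congr_ae (Eventually.of_forall fun x => ?_)
    simp only [hz, mul_pow]
    ring
  -- Only the top term of the Taylor polynomial survives, by `hj`.
  have hsum : ∫ x, (∑ k ∈ Finset.range (j + 1), (r * z x) ^ k / (k.factorial : ℂ)) * ψ x =
      (r : ℂ) ^ j * ((-(2 * Real.pi * Complex.I)) ^ j / j.factorial * dirMoment ψ j η) := by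
    simp only [Finset.sum_mul]
    rw [integral_finsetSum _ fun k _ => hint2 k, Finset.sum_range_succ, Finset.sum_eq_zero,
      zero_add, hterm]
    intro k hk
    rw [hterm, hj k (Finset.mem_range.mp hk)]
    simp
  have hdiff : 𝓕 ψ (r • η) - (r : ℂ) ^ j * ((-(2 * Real.pi * Complex.I)) ^ j / j.factorial *
      dirMoment ψ j η) = ∫ x, (Complex.exp (r * z x) -
        ∑ k ∈ Finset.range (j + 1), (r * z x) ^ k / (k.factorial : ℂ)) * ψ x := by
    rw [hF, ← hsum, ← integral_sub hint1]
    · refine integral_congr_ae (Eventually.of_forall fun x => ?_)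
      ring
    · simp only [Finset.sum_mul]
      exact integrable_finsetSum _ fun k _ => hint2 k
  have hbound : ‖𝓕 ψ (r • η) - (r : ℂ) ^ j * ((-(2 * Real.pi * Complex.I)) ^ j / j.factorial *
      dirMoment ψ j η)‖ ≤ r ^ (j + 1) * ∫ x, ‖z x‖ ^ (j + 1) * Real.exp ‖z x‖ * ‖ψ x‖ := by
    rw [hdiff, ← integral_const_mul]
    refine norm_integral_le_of_norm_le (hKint.const_mul _) (Eventually.of_forall fun x => ?_)
    rw [norm_mul, ← mul_assoc (r ^ (j + 1))]
    gcongr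
    refine (Complex.norm_exp_sub_sum_le_norm_mul_exp (r * z x) _).trans ?_
    rw [norm_mul (r : ℂ) (z x), Complex.norm_real, Real.norm_of_nonneg hr.le, mul_pow, mul_assoc]
    gcongr
    exact mul_le_of_le_one_left (norm_nonneg _) hr1
  have : 𝓕 ψ (r • η) / (r : ℂ) ^ j - (-(2 * Real.pi * Complex.I)) ^ j / j.factorial *
      dirMoment ψ j η = (𝓕 ψ (r • η) - (r : ℂ) ^ j * ((-(2 * Real.pi * Complex.I)) ^ j /
        j.factorial * dirMoment ψ j η)) / (r : ℂ) ^ j := by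
    rw [sub_div, mul_div_cancel_left₀ _ (pow_ne_zero _ hrc)]
  rw [this, norm_div, norm_pow, Complex.norm_real, Real.norm_of_nonneg hr.le,
    div_le_iff₀ (by positivity)]
  calc _ ≤ _ := hbound
    _ = _ := by ring

/-- If some moment of `ψ` of order `j ≤ s - d/2` does not vanish, then `|ξ|^{-s} 𝓕ψ` is not
square integrable. -/
theorem lintegral_fourier_sq_div_eq_top (hd : 1 ≤ d) {s : ℝ} (hs : 0 ≤ s)
    {ψ : EuclideanSpace ℝ (Fin d) → ℂ}
    (hψ : Integrable ψ) {ρ : ℝ} (hρ : ∀ x, ρ < ‖x‖ → ψ x = 0) {j : ℕ} (hjs : d + 2 * j ≤ 2 * s)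
    (hj : ∀ k < j, ∀ η, dirMoment ψ k η = 0) {η₀ : EuclideanSpace ℝ (Fin d)}
    (hη₀ : dirMoment ψ j η₀ ≠ 0) :
    ∫⁻ ξ, ENNReal.ofReal (‖𝓕 ψ ξ‖ ^ 2 * ((2 * Real.pi * ‖ξ‖) ^ (2 * s))⁻¹) = ⊤ := by
  by_contra hfin
  have hHc : Continuous (𝓕 ψ) := continuous_fourier_of_integrable hψ
  set f : EuclideanSpace ℝ (Fin d) → ℝ≥0∞ :=
    fun ξ => ENNReal.ofReal (‖𝓕 ψ ξ‖ ^ 2 * ((2 * Real.pi * ‖ξ‖) ^ (2 * s))⁻¹) with hf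
  have hwc : Continuous fun ξ : EuclideanSpace ℝ (Fin d) => (2 * Real.pi * ‖ξ‖) ^ (2 * s) :=
    (continuous_const.mul continuous_norm).rpow_const fun _ => Or.inr (by positivity)
  have hfm : Measurable f :=
    ((hHc.norm.pow 2).measurable.mul hwc.measurable.inv).ennreal_ofReal
  -- The radius is chosen so that the open ball contains `η₀`.
  set R : ℝ := ‖η₀‖ + 1 with hR
  set r : ℕ → ℝ := fun n => 1 / ((n : ℝ) + 1) with hr
  have hr0 : ∀ n, 0 < r n := fun n => Nat.one_div_pos_of_nat
  have hr1 : ∀ n, r n ≤ 1 := fun n => by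
    rw [hr, div_le_one (by positivity)]; simp
  have hrt : Tendsto r atTop (𝓝 0) := tendsto_one_div_add_atTop_nhds_zero_nat
  have hd0 : d ≠ 0 := by omega
  -- If the integral were finite, its mass on shrinking balls would vanish. Rescaling these balls to
  -- the fixed radius `R` bounds that mass below by an integral converging pointwise to a profile
  -- that is not a.e. zero. This scaling argument also covers the logarithmic case `d + 2j = 2s`.
  have hball : Tendsto (fun n => ∫⁻ ξ in Metric.ball 0 (r n * R), f ξ) atTop (𝓝 0) := by
    refine tendsto_setLIntegral_zero hfin ?_
    have h1 : ∀ n, volume (Metric.ball (0 : EuclideanSpace ℝ (Fin d)) (r n * R)) =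
        ENNReal.ofReal (r n ^ d) * volume (Metric.ball (0 : EuclideanSpace ℝ (Fin d)) R) :=
      fun n => by
        rw [Measure.addHaar_ball_mul_of_pos _ _ (hr0 n), finrank_euclideanSpace_fin]
    have h2 : Tendsto (fun n => ENNReal.ofReal (r n ^ d) *
        volume (Metric.ball (0 : EuclideanSpace ℝ (Fin d)) R)) atTop (𝓝 0) := by
      have h3 : Tendsto (fun n => ENNReal.ofReal (r n ^ d)) atTop (𝓝 0) := by
        have := ENNReal.tendsto_ofReal (hrt.pow d)
        rwa [zero_pow hd0, ENNReal.ofReal_zero] at this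
      have := ENNReal.Tendsto.mul_const h3
        (b := volume (Metric.ball (0 : EuclideanSpace ℝ (Fin d)) R))
        (Or.inr measure_ball_lt_top.ne)
      rwa [zero_mul] at this
    exact h2.congr fun n => (h1 n).symm
  set g : ℕ → EuclideanSpace ℝ (Fin d) → ℝ≥0∞ := fun n η =>
    ENNReal.ofReal (‖𝓕 ψ (r n • η) / (r n : ℂ) ^ j‖ ^ 2 * ((2 * Real.pi * ‖η‖) ^ (2 * s))⁻¹)
    with hg
  have hgm : ∀ n, Measurable (g n) := fun n => by
    have : Continuous fun η => 𝓕 ψ (r n • η) / (r n : ℂ) ^ j :=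
      (hHc.comp (continuous_const_smul _)).div_const _
    exact ((this.norm.pow 2).measurable.mul hwc.measurable.inv).ennreal_ofReal
  have hgle : ∀ n, ∫⁻ η in Metric.ball 0 R, g n η ≤
      ∫⁻ ξ in Metric.ball 0 (r n * R), f ξ := fun n => by
    rw [setLIntegral_ball_scale hfm (hr0 n), ← lintegral_const_mul]
    swap
    · exact hfm.comp (measurable_const_smul _)
    refine lintegral_mono fun η => ?_
    simp only [hg, hf]
    have hrn := hr0 n
    rw [← ENNReal.ofReal_mul (by positivity)]
    apply ENNReal.ofReal_le_ofReal
    rw [norm_smul, Real.norm_of_nonneg hrn.le, norm_div, norm_pow, Complex.norm_real,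
      Real.norm_of_nonneg hrn.le, show 2 * Real.pi * (r n * ‖η‖) = r n * (2 * Real.pi * ‖η‖) by ring,
      Real.mul_rpow hrn.le (by positivity), mul_inv, div_pow, div_eq_mul_inv]
    -- The order condition `d + 2j ≤ 2s` enters here, together with `r n ≤ 1`.
    have hpow : r n ^ (2 * s) ≤ r n ^ d * (r n ^ j) ^ 2 := by
      rw [← pow_mul, ← pow_add, ← Real.rpow_natCast]
      refine Real.rpow_le_rpow_of_exponent_ge hrn (hr1 n) ?_
      push_cast; linarith
    have hkey : ((r n ^ j) ^ 2)⁻¹ ≤ r n ^ d * (r n ^ (2 * s))⁻¹ := by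
      rw [← div_eq_mul_inv, le_div_iff₀ (by positivity), inv_mul_le_iff₀ (by positivity)]
      linarith
    calc _ = ‖𝓕 ψ (r n • η)‖ ^ 2 * ((2 * Real.pi * ‖η‖) ^ (2 * s))⁻¹ * ((r n ^ j) ^ 2)⁻¹ := by ring
      _ ≤ ‖𝓕 ψ (r n • η)‖ ^ 2 * ((2 * Real.pi * ‖η‖) ^ (2 * s))⁻¹ *
          (r n ^ d * (r n ^ (2 * s))⁻¹) := by gcongr
      _ = _ := by ring
  set G : EuclideanSpace ℝ (Fin d) → ℝ≥0∞ := fun η => ENNReal.ofReal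
    (‖(-(2 * Real.pi * Complex.I)) ^ j / j.factorial * dirMoment ψ j η‖ ^ 2 *
      ((2 * Real.pi * ‖η‖) ^ (2 * s))⁻¹) with hG
  have hgG : ∀ η, Tendsto (fun n => g n η) atTop (𝓝 (G η)) := fun η => by
    refine ENNReal.tendsto_ofReal (((Tendsto.norm ?_).pow 2).mul_const _)
    obtain ⟨K, hK⟩ := norm_fourier_sub_le hψ hρ hj η
    rw [tendsto_iff_norm_sub_tendsto_zero]
    refine squeeze_zero (fun _ => norm_nonneg _) (fun n => hK (r n) (hr0 n) (hr1 n)) ?_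
    simpa using hrt.mul_const K
  have hG0 : ∫⁻ η in Metric.ball 0 R, G η = 0 := by
    refine le_antisymm ?_ bot_le
    calc ∫⁻ η in Metric.ball 0 R, G η
        = ∫⁻ η in Metric.ball 0 R, liminf (fun n => g n η) atTop := by
          congr 1; ext η; exact (hgG η).liminf_eq.symm
      _ ≤ liminf (fun n => ∫⁻ η in Metric.ball 0 R, g n η) atTop := lintegral_liminf_le hgm
      _ ≤ liminf (fun n => ∫⁻ ξ in Metric.ball 0 (r n * R), f ξ) atTop :=
          liminf_le_liminf (Eventually.of_forall hgle)
      _ = 0 := hball.liminf_eq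
  have hGm : Measurable G := by
    have : Continuous fun η => (-(2 * Real.pi * Complex.I)) ^ j / j.factorial * dirMoment ψ j η :=
      continuous_const.mul (continuous_dirMoment hψ hρ j)
    exact ((this.norm.pow 2).measurable.mul hwc.measurable.inv).ennreal_ofReal
  rw [lintegral_eq_zero_iff hGm, EventuallyEq, ae_restrict_iff' Metric.isOpen_ball.measurableSet]
    at hG0
  have : Nontrivial (EuclideanSpace ℝ (Fin d)) := by
    apply Module.nontrivial_of_finrank_pos (R := ℝ)
    rw [finrank_euclideanSpace_fin]; omega
  set U : Set (EuclideanSpace ℝ (Fin d)) := Metric.ball 0 R ∩ {η | dirMoment ψ j η ≠ 0} with hU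
  have hUo : IsOpen U := Metric.isOpen_ball.inter
    (isOpen_ne_fun (continuous_dirMoment hψ hρ j) continuous_const)
  have hUpos : volume U ≠ 0 := (hUo.measure_pos volume ⟨η₀, by simp [hR], hη₀⟩).ne'
  apply hUpos
  have hne : ∀ᵐ η : EuclideanSpace ℝ (Fin d), η ≠ 0 := by
    simp [ae_iff, measure_singleton]
  refine measure_mono_null (t := {η | ¬ (η ∉ U)}) (fun η h => by simpa using h) (ae_iff.mp ?_)
  filter_upwards [hG0, hne] with η h1 h2 h3
  have h4 := h1 h3.1
  have h5 : 0 < ‖η‖ := norm_pos_iff.mpr h2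
  have h6 : 0 < ‖(-(2 * Real.pi * Complex.I)) ^ j / j.factorial * dirMoment ψ j η‖ := by
    rw [norm_pos_iff]
    refine mul_ne_zero (div_ne_zero (pow_ne_zero _ ?_) ?_) h3.2
    · simp [Real.pi_ne_zero]
    · exact_mod_cast j.factorial_ne_zero
  simp only [hG, Pi.zero_apply, ENNReal.ofReal_eq_zero] at h4
  have : 0 < ‖(-(2 * Real.pi * Complex.I)) ^ j / j.factorial * dirMoment ψ j η‖ ^ 2 *
      ((2 * Real.pi * ‖η‖) ^ (2 * s))⁻¹ := by positivity
  exact absurd h4 (not_le.mpr this)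

end LowFrequency

/-! ### Blow-up of the Birman–Schwinger form on `𝓕_n`. -/

section TrialSpace

open Filter Topology
open scoped InnerProductSpace BoundedContinuousFunction

variable {d : ℕ}

theorem exists_bcf_eq {f : EuclideanSpace ℝ (Fin d) → ℝ} (hf : Continuous f)
    (hfc : HasCompactSupport f) : ∃ g : EuclideanSpace ℝ (Fin d) →ᵇ ℝ, ⇑g = f := by
  obtain ⟨C, hC⟩ := hfc.exists_bound_of_continuous hf
  exact ⟨BoundedContinuousFunction.ofNormedAddCommGroup f hf C hC, rfl⟩

theorem HasCompactSupport.sqrt_comp {V : EuclideanSpace ℝ (Fin d) → ℝ}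
    (hV : HasCompactSupport V) : HasCompactSupport fun x => √(V x) :=
  hV.comp_left (g := Real.sqrt) Real.sqrt_zero

theorem memLp_monomial_mul_sqrt {V : EuclideanSpace ℝ (Fin d) → ℝ} (hV : Continuous V)
    (hVc : HasCompactSupport V) (α : Fin d → ℕ) :
    MemLp (fun x : EuclideanSpace ℝ (Fin d) => (((∏ i, x i ^ α i) * √(V x) : ℝ) : ℂ)) 2 volume := by
  have h1 : Continuous fun x : EuclideanSpace ℝ (Fin d) => (∏ i, x i ^ α i) * √(V x) := by
    fun_prop
  exact (h1.memLp_of_hasCompactSupport hVc.sqrt_comp.mul_left).ofReal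

/-- The functions `x^α √V`, `|α| ≤ n`, as elements of `L²`. -/
noncomputable def polyVec {V : EuclideanSpace ℝ (Fin d) → ℝ} (hV : Continuous V)
    (hVc : HasCompactSupport V) (α : Fin d → ℕ) : L2Space d :=
  (memLp_monomial_mul_sqrt hV hVc α).toLp _

theorem polySpan_eq_span_range {V : EuclideanSpace ℝ (Fin d) → ℝ} (hV : Continuous V)
    (hVc : HasCompactSupport V) (n : ℕ) : polySpan d n V = Submodule.span ℂ
      (Set.range fun α : {α : Fin d → ℕ // ∑ i, α i ≤ n} => polyVec hV hVc α) := by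
  unfold polySpan
  congr 1
  ext u
  constructor
  · rintro ⟨α, hα, hu⟩
    exact ⟨⟨α, hα⟩, Lp.ext ((memLp_monomial_mul_sqrt hV hVc α).coeFn_toLp.trans hu.symm)⟩
  · rintro ⟨⟨α, hα⟩, rfl⟩
    exact ⟨α, hα, (memLp_monomial_mul_sqrt hV hVc α).coeFn_toLp⟩

instance finite_bounded_multiindex (d n : ℕ) : Finite {α : Fin d → ℕ // ∑ i, α i ≤ n} := by
  refine Set.Finite.to_subtype (Set.Finite.subset (Set.finite_Iic (fun _ : Fin d => n)) ?_)
  intro α hα i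
  exact (Finset.single_le_sum (f := α) (fun _ _ => Nat.zero_le _) (Finset.mem_univ i)).trans hα

theorem finiteDimensional_polySpan {V : EuclideanSpace ℝ (Fin d) → ℝ} (hV : Continuous V)
    (hVc : HasCompactSupport V) (n : ℕ) : FiniteDimensional ℂ (polySpan d n V) := by
  rw [polySpan_eq_span_range hV hVc]
  exact FiniteDimensional.span_of_finite ℂ (Set.finite_range _)

/-- This turns orthogonality to `𝓕_n` into vanishing of the moments of `√V f`. -/
theorem inner_polyVec {V : EuclideanSpace ℝ (Fin d) → ℝ} (hV : Continuous V)
    (hVc : HasCompactSupport V) (α : Fin d → ℕ) (f : L2Space d) :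
    ⟪polyVec hV hVc α, f⟫_ℂ = mixedMoment (fun x => (√(V x) : ℂ) * f x) α := by
  rw [L2.inner_def, mixedMoment]
  apply integral_congr_ae
  filter_upwards [(memLp_monomial_mul_sqrt hV hVc α).coeFn_toLp] with x hx
  rw [RCLike.inner_apply, polyVec, hx, Complex.conj_ofReal]
  push_cast; ring

/-- On nonzero elements `f` of the span of `x^α √V`, `|α| ≤ s - d/2`, the quadratic form of
`√V ((-Δ)^s + e)⁻¹ √V` tends to infinity as `e → 0`. -/
theorem exists_lt_energy (hd : 1 ≤ d) {s : ℝ} (hs : (d : ℝ) / 2 ≤ s) (hs0 : 0 ≤ s)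
    {V : EuclideanSpace ℝ (Fin d) → ℝ} (hV : Continuous V) (hVc : HasCompactSupport V)
    (Q : EuclideanSpace ℝ (Fin d) →ᵇ ℝ) (hQ : ∀ x, Q x = √(V x))
    {f : L2Space d} (hf : f ∈ polySpan d ⌊s - (d : ℝ) / 2⌋₊ V) (hf0 : f ≠ 0) (C : ℝ) :
    ∃ k : ℕ, C < (⟪fourierMul (resolventSymbol d hs0 (Nat.one_div_pos_of_nat (n := k)))
      (bcfMul Q f), bcfMul Q f⟫_ℂ).re := by
  by_contra! hle
  set ψ : EuclideanSpace ℝ (Fin d) → ℂ := fun x => (√(V x) : ℂ) * f x with hψdef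
  have hψae : bcfMul Q f =ᵐ[volume] ψ := by
    filter_upwards [coeFn_bcfMul Q f] with x hx
    rw [hx, hQ]
  have hQfun : ⇑Q = fun x => √(V x) := funext hQ
  have hQ2 : MemLp Q 2 volume := by
    rw [hQfun]
    exact (by fun_prop : Continuous fun x => √(V x)).memLp_of_hasCompactSupport hVc.sqrt_comp
  have hint : Integrable (bcfMul Q f) := integrable_bcfMul hQ2 f
  have hψ : Integrable ψ := hint.congr hψae
  obtain ⟨ρ, hρ'⟩ := hVc.isBounded.subset_closedBall 0
  have hρ : ∀ x, ρ < ‖x‖ → ψ x = 0 := fun x hx => by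
    have h1 : x ∉ tsupport V := fun h => absurd (mem_closedBall_zero_iff.mp (hρ' h)) (not_le.mpr hx)
    simp [hψdef, image_eq_zero_of_notMem_tsupport h1]
  set n := ⌊s - (d : ℝ) / 2⌋₊ with hn
  have hex : ∃ k, ∃ η, dirMoment ψ k η ≠ 0 ∧ k ≤ n := by
    by_contra! hall
    have hzero : ∀ k ≤ n, ∀ η, dirMoment ψ k η = 0 := fun k hk η => by
      by_contra hne
      exact absurd hk (not_le.mpr (hall k η hne))
    apply hf0
    -- With all moments up to order `n` zero, `f` is orthogonal to a space containing it.
    have hperp : polySpan d n V ≤ (ℂ ∙ f)ᗮ := by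
      rw [polySpan_eq_span_range hV hVc, Submodule.span_le]
      rintro _ ⟨⟨α, hα⟩, rfl⟩
      rw [SetLike.mem_coe, Submodule.mem_orthogonal_singleton_iff_inner_left, inner_polyVec]
      exact mixedMoment_eq_zero_of_dirMoment hψ hρ (hzero _ hα) rfl
    have := hperp hf
    rw [Submodule.mem_orthogonal_singleton_iff_inner_left] at this
    exact inner_self_eq_zero.mp this
  classical
  obtain ⟨η₀, hη₀, hjn⟩ := Nat.find_spec hex
  have hmin : ∀ k < Nat.find hex, ∀ η, dirMoment ψ k η = 0 := fun k hk η => by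
    by_contra hne
    exact Nat.find_min hex hk ⟨η, hne, hk.le.trans hjn⟩
  have hjs : (d : ℝ) + 2 * (Nat.find hex : ℕ) ≤ 2 * s := by
    have h1 : ((Nat.find hex : ℕ) : ℝ) ≤ n := by exact_mod_cast hjn
    have h2 : (n : ℝ) ≤ s - (d : ℝ) / 2 := Nat.floor_le (by linarith)
    linarith
  have htop := lintegral_fourier_sq_div_eq_top hd hs0 hψ hρ hjs hmin hη₀
  have hF : Lp.fourierTransformₗᵢ (EuclideanSpace ℝ (Fin d)) ℂ (bcfMul Q f) =ᵐ[volume] 𝓕 ψ := by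
    filter_upwards [coeFn_fourier (bcfMul Q f) hint] with ξ hξ
    rw [hξ, Real.fourier_congr_ae hψae]
  have : Nontrivial (EuclideanSpace ℝ (Fin d)) := by
    apply Module.nontrivial_of_finrank_pos (R := ℝ)
    rw [finrank_euclideanSpace_fin]; omega
  have hne : ∀ᵐ η : EuclideanSpace ℝ (Fin d), η ≠ 0 := by
    simp [ae_iff, measure_singleton]
  set g : ℕ → EuclideanSpace ℝ (Fin d) →ᵇ ℝ := fun k =>
    resolventSymbol d hs0 (Nat.one_div_pos_of_nat (n := k)) with hg
  have hHc : Continuous (𝓕 ψ) := continuous_fourier_of_integrable hψ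
  have hgk : ∀ k, ∫⁻ ξ, ENNReal.ofReal (‖𝓕 ψ ξ‖ ^ 2 * g k ξ) ≤ ENNReal.ofReal C := fun k => by
    have h1 := hle k
    rw [inner_fourierMul, re_inner_bcfMul] at h1
    have h2 := integrable_bcf_mul_norm_sq (g k)
      (Lp.fourierTransformₗᵢ (EuclideanSpace ℝ (Fin d)) ℂ (bcfMul Q f))
    refine le_trans (le_of_eq ?_) (ENNReal.ofReal_le_ofReal h1)
    rw [ofReal_integral_eq_lintegral_ofReal h2]
    · apply lintegral_congr_ae
      filter_upwards [hF] with ξ hξ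
      rw [hξ, mul_comm]
    · exact Eventually.of_forall fun ξ =>
        mul_nonneg (resolventSymbol_nonneg hs0 _ ξ) (by positivity)
  -- Fatou as `e = 1/(k+1) → 0`: a bound on the energies uniform in `k` would pass to the divergent
  -- integral.
  have hfatou : ∫⁻ ξ, ENNReal.ofReal (‖𝓕 ψ ξ‖ ^ 2 * ((2 * Real.pi * ‖ξ‖) ^ (2 * s))⁻¹) ≤
      ENNReal.ofReal C := by
    calc _ = ∫⁻ ξ, liminf (fun k => ENNReal.ofReal (‖𝓕 ψ ξ‖ ^ 2 * g k ξ)) atTop := by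
          apply lintegral_congr_ae
          filter_upwards [hne] with ξ hξ
          refine (Tendsto.liminf_eq (ENNReal.tendsto_ofReal (Tendsto.const_mul _ ?_))).symm
          have hξ' : 0 < ‖ξ‖ := norm_pos_iff.mpr hξ
          have h0 : Tendsto (fun k : ℕ => (2 * Real.pi * ‖ξ‖) ^ (2 * s) + 1 / ((k : ℝ) + 1)) atTop
              (𝓝 ((2 * Real.pi * ‖ξ‖) ^ (2 * s))) := by
            simpa using (tendsto_const_nhds
              (x := (2 * Real.pi * ‖ξ‖) ^ (2 * s))).add tendsto_one_div_add_atTop_nhds_zero_nat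
          exact h0.inv₀ (by positivity)
      _ ≤ liminf (fun k => ∫⁻ ξ, ENNReal.ofReal (‖𝓕 ψ ξ‖ ^ 2 * g k ξ)) atTop :=
          lintegral_liminf_le fun k =>
            ((hHc.norm.pow 2).mul (g k).continuous).measurable.ennreal_ofReal
      _ ≤ liminf (fun _ : ℕ => ENNReal.ofReal C) atTop :=
          liminf_le_liminf (Eventually.of_forall hgk)
      _ = ENNReal.ofReal C := liminf_const _
  rw [htop] at hfatou
  exact ENNReal.ofReal_ne_top (top_le_iff.mp hfatou)

/-- A monotone family of quadratic forms that is pointwise eventually above `1` on a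
finite-dimensional space eventually dominates the square of the norm. -/
theorem exists_forall_norm_sq_lt {H : Type*} [NormedAddCommGroup H] [NormedSpace ℂ H]
    (P : Submodule ℂ H) [FiniteDimensional ℂ P] (q : ℕ → H → ℝ) (hqc : ∀ k, Continuous (q k))
    (hqm : ∀ f, Monotone fun k => q k f)
    (hqs : ∀ k (a : ℝ) f, q k ((a : ℂ) • f) = a ^ 2 * q k f)
    (hq : ∀ f ∈ P, f ≠ 0 → ∃ k, 1 < q k f) : ∃ k, ∀ f ∈ P, f ≠ 0 → ‖f‖ ^ 2 < q k f := by
  have : ProperSpace P := FiniteDimensional.proper ℂ P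
  -- The open sets `{1 < q k}` cover the unit sphere and increase with `k`, so a single one of them
  -- suffices.
  obtain ⟨k, hk⟩ := (isCompact_sphere (0 : P) 1).elim_directed_cover
    (fun k => {f : P | 1 < q k f}) (fun k => isOpen_lt continuous_const
      ((hqc k).comp continuous_subtype_val)) (fun f hf => by
      have hf0 : (f : H) ≠ 0 := by
        intro h
        have : f = 0 := Subtype.ext h
        simp [this] at hf
      exact Set.mem_iUnion.mpr (hq f f.2 hf0))
    (Monotone.directed_le fun k l hkl f hf => lt_of_lt_of_le hf (hqm f hkl))
  refine ⟨k, fun f hf hf0 => ?_⟩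
  have hfn : 0 < ‖f‖ := norm_pos_iff.mpr hf0
  have h1 : (⟨((‖f‖⁻¹ : ℝ) : ℂ) • f, P.smul_mem _ hf⟩ : P) ∈ Metric.sphere (0 : P) 1 := by
    rw [mem_sphere_zero_iff_norm, Submodule.coe_norm, norm_smul, Complex.norm_real, norm_inv,
      norm_norm, inv_mul_cancel₀ hfn.ne']
  have h2 : 1 < q k (((‖f‖⁻¹ : ℝ) : ℂ) • f) := hk h1
  rw [hqs, inv_pow, inv_mul_eq_div, one_lt_div (by positivity)] at h2
  exact h2

/-- One value of `e` serves all nonzero elements of the trial space. -/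
theorem exists_uniform_lt_energy (hd : 1 ≤ d) {s : ℝ} (hs : (d : ℝ) / 2 ≤ s) (hs0 : 0 ≤ s)
    {V : EuclideanSpace ℝ (Fin d) → ℝ} (hV : Continuous V) (hVc : HasCompactSupport V)
    (Q : EuclideanSpace ℝ (Fin d) →ᵇ ℝ) (hQ : ∀ x, Q x = √(V x)) :
    ∃ (e : ℝ) (he : 0 < e), ∀ f ∈ polySpan d ⌊s - (d : ℝ) / 2⌋₊ V, f ≠ 0 →
      ‖f‖ ^ 2 < (⟪fourierMul (resolventSymbol d hs0 he) (bcfMul Q f), bcfMul Q f⟫_ℂ).re := by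
  have := finiteDimensional_polySpan hV hVc ⌊s - (d : ℝ) / 2⌋₊
  obtain ⟨k, hk⟩ := exists_forall_norm_sq_lt (polySpan d ⌊s - (d : ℝ) / 2⌋₊ V)
    (fun k f => (⟪fourierMul (resolventSymbol d hs0 (Nat.one_div_pos_of_nat (n := k)))
      (bcfMul Q f), bcfMul Q f⟫_ℂ).re)
    (fun k => Complex.continuous_re.comp (((ContinuousLinearMap.continuous _).comp
      (bcfMul Q).continuous).inner (bcfMul Q).continuous))
    (fun f k l hkl => by
      dsimp only
      rw [inner_fourierMul, inner_fourierMul]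
      apply re_inner_bcfMul_mono
      intro ξ
      rw [resolventSymbol_apply, resolventSymbol_apply]
      have : (0 : ℝ) < (k : ℝ) + 1 := by positivity
      gcongr)
    (fun k a f => by
      simp only [map_smul, inner_smul_left, inner_smul_right, Complex.conj_ofReal,
        Complex.re_ofReal_mul]
      ring)
    (fun f hf hf0 => exists_lt_energy hd hs hs0 hV hVc Q hQ hf hf0 1)
  exact ⟨1 / ((k : ℝ) + 1), Nat.one_div_pos_of_nat, hk⟩

end TrialSpace

/-! ### The lower bound for the number of negative eigenvalues. -/

section Counting

open Filter Topology
open scoped InnerProductSpace BoundedContinuousFunction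

/-- The eigenvectors of `T` with negative eigenvalue. -/
def negEigenvectors {H : Type*} [AddCommGroup H] [Module ℂ H] (T : H →ₗ.[ℂ] H) : Set H :=
  {u | ∃ E : ℝ, E < 0 ∧ ∃ x : T.domain, (x : H) = u ∧ T x = (E : ℂ) • (x : H)}

theorem dimENat_eq_finrank (W : Type*) [AddCommGroup W] [Module ℂ W] [FiniteDimensional ℂ W] :
    dimENat W = Module.finrank ℂ W := by
  rw [dimENat, ← Module.finrank_eq_rank, Cardinal.toENat_nat]

theorem finiteDimensional_of_dimENat_lt_top {W : Type*} [AddCommGroup W] [Module ℂ W]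
    (h : dimENat W < ⊤) : FiniteDimensional ℂ W := by
  rw [FiniteDimensional, ← Module.rank_lt_aleph0_iff]
  by_contra! hle
  rw [dimENat, Cardinal.toENat_eq_top.mpr hle] at h
  exact lt_irrefl _ h

/-- If `T` has fewer than `k` negative eigenvalues, then the corresponding eigenvectors span a
space of dimension less than `k`. -/
theorem finrank_span_negEigenvectors_lt {H : Type*} [AddCommGroup H] [Module ℂ H]
    (T : H →ₗ.[ℂ] H) {k : ℕ} (hk : numNegEigenvalues T < k) :
    FiniteDimensional ℂ (Submodule.span ℂ (negEigenvectors T)) ∧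
      Module.finrank ℂ (Submodule.span ℂ (negEigenvectors T)) < k := by
  classical
  have htop : numNegEigenvalues T < ⊤ := lt_of_lt_of_le hk le_top
  -- A finite supremum in `ℕ∞` is attained. Adding an energy outside the maximizing `S` cannot
  -- increase the sum, so its eigenspace is trivial.
  obtain ⟨S, hS⟩ := ENat.exists_eq_iSup_of_lt_top htop
  change _ = numNegEigenvalues T at hS
  have hle : ∀ S' : Finset (Set.Iio (0 : ℝ)),
      ∑ E ∈ S', dimENat (pmapEigenspace T E) ≤ numNegEigenvalues T := fun S' =>
    le_iSup (fun S' : Finset (Set.Iio (0 : ℝ)) => ∑ E ∈ S', dimENat (pmapEigenspace T E)) S'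
  have hfin : ∀ E : Set.Iio (0 : ℝ), FiniteDimensional ℂ (pmapEigenspace T E) := fun E => by
    apply finiteDimensional_of_dimENat_lt_top
    have := hle {E}
    rw [Finset.sum_singleton] at this
    exact this.trans_lt htop
  have hzero : ∀ E ∉ S, dimENat (pmapEigenspace T (E : Set.Iio (0 : ℝ))) = 0 := fun E hE => by
    have h1 := hle (insert E S)
    rw [Finset.sum_insert hE, hS] at h1
    by_contra hne
    exact absurd h1 (not_le.mpr
      (ENat.lt_add_left htop.ne (pos_iff_ne_zero.mpr hne)))
  have hlt : ∑ E ∈ S, Module.finrank ℂ (pmapEigenspace T (E : Set.Iio (0 : ℝ))) < k := by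
    rw [← hS] at hk
    simp only [dimENat_eq_finrank] at hk
    exact_mod_cast hk
  set Ψ : (∀ E : S, pmapEigenspace T (E : Set.Iio (0 : ℝ))) →ₗ[ℂ] H :=
    ∑ E : S, T.domain.subtype ∘ₗ (pmapEigenspace T (E : Set.Iio (0 : ℝ))).subtype ∘ₗ
      LinearMap.proj E with hΨ
  have hsub : Submodule.span ℂ (negEigenvectors T) ≤ LinearMap.range Ψ := by
    rw [Submodule.span_le]
    rintro u ⟨E, hE, x, rfl, hx⟩
    have hxE : x ∈ pmapEigenspace T E := by
      rw [pmapEigenspace, LinearMap.mem_ker, LinearMap.sub_apply, sub_eq_zero]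
      exact hx
    by_cases hES : (⟨E, hE⟩ : Set.Iio (0 : ℝ)) ∈ S
    · refine ⟨Pi.single ⟨⟨E, hE⟩, hES⟩ ⟨x, hxE⟩, ?_⟩
      rw [hΨ, LinearMap.sum_apply, Finset.sum_eq_single ⟨⟨E, hE⟩, hES⟩]
      · simp
      · intro E' _ hne
        simp [Pi.single_eq_of_ne hne]
      · intro h; exact absurd (Finset.mem_univ _) h
    · have h0 := hzero ⟨E, hE⟩ hES
      rw [dimENat, Cardinal.toENat_eq_zero, rank_zero_iff] at h0
      have : (⟨x, hxE⟩ : pmapEigenspace T E) = 0 := Subsingleton.elim _ _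
      have hx0 : x = 0 := congrArg Subtype.val this
      rw [hx0]
      exact Submodule.zero_mem _
  have hfd : FiniteDimensional ℂ (Submodule.span ℂ (negEigenvectors T)) :=
    Submodule.finiteDimensional_of_le hsub
  refine ⟨hfd, ?_⟩
  calc Module.finrank ℂ (Submodule.span ℂ (negEigenvectors T))
      ≤ Module.finrank ℂ (LinearMap.range Ψ) := Submodule.finrank_mono hsub
    _ ≤ Module.finrank ℂ (∀ E : S, pmapEigenspace T (E : Set.Iio (0 : ℝ))) :=
        LinearMap.finrank_range_le _
    _ = ∑ E : S, Module.finrank ℂ (pmapEigenspace T (E : Set.Iio (0 : ℝ))) :=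
        Module.finrank_pi_fintype ℂ
    _ = ∑ E ∈ S, Module.finrank ℂ (pmapEigenspace T (E : Set.Iio (0 : ℝ))) :=
        Finset.sum_coe_sort S fun E => Module.finrank ℂ (pmapEigenspace T (E : Set.Iio (0 : ℝ)))
    _ < k := hlt

variable {d : ℕ}

/-- A dimension count puts some trial function `R_e √V f` with `f ≠ 0` in the orthogonal complement
of the span of the negative eigenvectors. The form is negative there, which forces a further
negative eigenvector orthogonal to its own span. -/
theorem le_numNegEigenvalues (hd : 1 ≤ d) {s : ℝ} (hs : (d : ℝ) / 2 ≤ s)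
    {V : EuclideanSpace ℝ (Fin d) → ℝ} (hV : IsTestPotential V) :
    dimENat (polySpan d ⌊s - (d : ℝ) / 2⌋₊ V) ≤ numNegEigenvalues (fracSchrodinger d s V) := by
  have hVcont := hV.smooth.continuous
  have hVc := hV.compact_support
  have hs0 : 0 ≤ s := le_trans (by positivity) hs
  obtain ⟨Vb, rfl⟩ := exists_bcf_eq hVcont hVc
  obtain ⟨Q, hQ'⟩ := exists_bcf_eq (f := fun x => √(Vb x)) (by fun_prop) hVc.sqrt_comp
  have hQ : ∀ x, Q x = √(Vb x) := fun x => by rw [hQ']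
  have hQQ : Q * Q = Vb := by
    ext x
    rw [BoundedContinuousFunction.mul_apply, hQ, Real.mul_self_sqrt (hV.nonneg x)]
  set P := polySpan d ⌊s - (d : ℝ) / 2⌋₊ Vb
  have : FiniteDimensional ℂ P := finiteDimensional_polySpan hVcont hVc _
  rw [dimENat_eq_finrank]
  by_contra! hlt
  obtain ⟨hfd, hrank⟩ := finrank_span_negEigenvectors_lt _ hlt
  set W := Submodule.span ℂ (negEigenvectors (fracSchrodinger d s Vb))
  obtain ⟨e, he, hen⟩ := exists_uniform_lt_energy hd hs hs0 hVcont hVc Q hQ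
  -- This shift gives both `V ≤ c` and `‖V R_c‖ ≤ ‖V‖ / c < 1`, as the abstract criterion requires.
  set c : ℝ := ‖Vb‖ + 1 with hc
  have hVb0 : 0 ≤ ‖Vb‖ := norm_nonneg _
  have hc0 : 0 < c := by positivity
  set Re := fourierMul (resolventSymbol d hs0 he)
  set Rc := fourierMul (resolventSymbol d hs0 hc0)
  have hker : LinearMap.ker ((W.orthogonalProjectionOnto : L2Space d →ₗ[ℂ] W) ∘ₗ
      (Re : L2Space d →ₗ[ℂ] L2Space d) ∘ₗ (bcfMul Q : L2Space d →ₗ[ℂ] L2Space d) ∘ₗ P.subtype) ≠ ⊥ :=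
    LinearMap.ker_ne_bot_of_finrank_lt hrank
  obtain ⟨f, hfk, hf0⟩ := (Submodule.ne_bot_iff _).mp hker
  have hperp : Re (bcfMul Q f) ∈ Wᗮ := by
    rw [← Submodule.orthogonalProjectionOnto_eq_zero_iff]
    exact hfk
  have hf0' : (f : L2Space d) ≠ 0 := fun h => hf0 (Subtype.ext h)
  set φ := Re (bcfMul Q f)
  -- Since `((-Δ)^s + e) φ = √V f`, this is `((-Δ)^s + c) φ`: it presents `φ` through the resolvent
  -- at `-c`.
  set w₀ := bcfMul Q (f : L2Space d) + ((c - e : ℝ) : ℂ) • φ with hw₀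
  have hRw : Rc w₀ = φ := (resolvent_eq_resolvent hs0 he hc0 _).symm
  have henergy := hen f f.2 hf0'
  have hself : ∀ u : L2Space d, (⟪u, u⟫_ℂ).re = ‖u‖ ^ 2 := fun u => by
    rw [inner_self_eq_norm_sq_to_K]; norm_cast
  have hVφ : (⟪bcfMul Vb φ, φ⟫_ℂ).re = ‖bcfMul Q φ‖ ^ 2 := by rw [norm_sq_bcfMul, hQQ]
  -- With `q` the left side, `‖f‖² < q ≤ ‖f‖ ‖√V φ‖`. So `‖f‖ < ‖√V φ‖`, and then `q < ‖√V φ‖²`.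
  have hq : (⟪bcfMul Q (f : L2Space d), φ⟫_ℂ).re < ‖bcfMul Q φ‖ ^ 2 := by
    have h1 : (⟪φ, bcfMul Q (f : L2Space d)⟫_ℂ).re = (⟪bcfMul Q (f : L2Space d), φ⟫_ℂ).re :=
      inner_re_symm (𝕜 := ℂ) _ _
    have h2 : (⟪bcfMul Q (f : L2Space d), φ⟫_ℂ).re ≤ ‖(f : L2Space d)‖ * ‖bcfMul Q φ‖ := by
      rw [inner_bcfMul_left]
      exact (Complex.re_le_norm _).trans (norm_inner_le_norm _ _)
    change ‖(f : L2Space d)‖ ^ 2 < (⟪φ, bcfMul Q (f : L2Space d)⟫_ℂ).re at henergy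
    rw [h1] at henergy
    set q := (⟪bcfMul Q (f : L2Space d), φ⟫_ℂ).re
    have hfn : 0 < ‖(f : L2Space d)‖ := norm_pos_iff.mpr hf0'
    have h3 : ‖(f : L2Space d)‖ < ‖bcfMul Q φ‖ := by
      refine lt_of_mul_lt_mul_left (lt_of_lt_of_le ?_ h2) hfn.le
      rwa [← sq]
    nlinarith
  have hneg : (⟪w₀ - (c : ℂ) • Rc w₀ - bcfMul Vb (Rc w₀), Rc w₀⟫_ℂ).re < 0 := by
    rw [hRw]
    have h1 : w₀ - (c : ℂ) • φ - bcfMul Vb φ =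
        bcfMul Q (f : L2Space d) - (e : ℂ) • φ - bcfMul Vb φ := by
      rw [hw₀]; push_cast; rw [sub_smul]; abel
    rw [h1, inner_sub_left, inner_sub_left, inner_smul_left, Complex.conj_ofReal, Complex.sub_re,
      Complex.sub_re, Complex.re_ofReal_mul, hself, hVφ]
    have : 0 ≤ e * ‖φ‖ ^ 2 := by positivity
    linarith
  have hVRlt : ‖bcfMul Vb * Rc‖ < 1 := by
    calc ‖bcfMul Vb * Rc‖ ≤ ‖(bcfMul Vb : L2Space d →L[ℂ] L2Space d)‖ * ‖Rc‖ := norm_mul_le _ _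
      _ ≤ ‖Vb‖ * c⁻¹ := by
        gcongr
        · exact norm_bcfMul_le Vb
        · exact (norm_fourierMul_le _).trans (norm_resolventSymbol_le hs0 hc0)
      _ < 1 := by rw [← div_eq_mul_inv, div_lt_one hc0]; linarith
  have hVle : ∀ u : L2Space d, (⟪bcfMul Vb u, u⟫_ℂ).re ≤ c * ‖u‖ ^ 2 := fun u => by
    calc (⟪bcfMul Vb u, u⟫_ℂ).re ≤ ‖bcfMul Vb u‖ * ‖u‖ :=
          (Complex.re_le_norm _).trans (norm_inner_le_norm _ _)
      _ ≤ (‖Vb‖ * ‖u‖) * ‖u‖ := by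
          gcongr; exact (bcfMul Vb).le_of_opNorm_le (norm_bcfMul_le Vb) u
      _ = ‖Vb‖ * ‖u‖ ^ 2 := by ring
      _ ≤ c * ‖u‖ ^ 2 := by gcongr; linarith
  have hVbmem : MemLp Vb 2 volume := by
    exact hVcont.memLp_of_hasCompactSupport hVc
  have hSeig : ∀ u ∈ negEigenvectors (fracSchrodinger d s Vb), ∃ E : ℝ, ∃ w, Rc w = u ∧
      w - (c : ℂ) • u - bcfMul Vb u = (E : ℂ) • u := by
    rintro u ⟨E, hE, x, rfl, hx⟩
    obtain ⟨w, hw, hTw⟩ := fracSchrodinger_exists_resolvent hs0 hc0 Vb x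
    exact ⟨E, w, hw, by rw [← hTw, hx]⟩
  rw [← hRw] at hperp
  obtain ⟨E, hE, u, huW, hu0, w, hwu, hwE⟩ := exists_negative_eigenvector_orthogonal Rc (bcfMul Vb)
    hc0 (inner_fourierMul_left _) (inner_bcfMul_left Vb) (resolvent_coercive hs0 hc0) hVle hVRlt
    (exists_subseq_bcfMul_fourierMul_tendsto (memLp_resolventSymbol hd hs hs0 hc0) hVbmem)
    _ hSeig hperp hneg
  have huS : u ∈ W := by
    apply Submodule.subset_span
    obtain ⟨x, hx, hTx⟩ := fracSchrodinger_resolvent hs0 hc0 Vb w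
    refine ⟨E, hE, x, hx.trans hwu, ?_⟩
    rw [hTx, hx]
    change w - (c : ℂ) • Rc w - bcfMul Vb (Rc w) = (E : ℂ) • Rc w
    rw [hwu, hwE]
  have := (Submodule.mem_orthogonal _ _).mp huW u huS
  exact hu0 (inner_self_eq_zero.mp this)

end Counting

/-! ### Full dimension of `𝓕_n` and scaling in the coupling constant. -/

section Sharpness

open Filter Topology

/-- A slack variable turns degree at most `n` in `d` variables into degree exactly `n` in `d + 1`
variables, counted by stars and bars. -/
theorem natCard_bounded_multiindex (d n : ℕ) :
    Nat.card {α : Fin d → ℕ // ∑ i, α i ≤ n} = (d + n).choose d := by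
  have e : {α : Fin d → ℕ // ∑ i, α i ≤ n} ≃
      (Finset.piAntidiag (Finset.univ : Finset (Fin (d + 1))) n) :=
    { toFun := fun α => ⟨Fin.cons (n - ∑ i, α.1 i) α.1, by
        have := α.2
        simp [Fin.sum_univ_succ, this]⟩
      invFun := fun β => ⟨Fin.tail β.1, by
        have h := (Finset.mem_piAntidiag.mp β.2).1
        rw [Fin.sum_univ_succ] at h
        simp only [Fin.tail]
        omega⟩
      left_inv := fun α => by simp
      right_inv := fun β => by
        have h := (Finset.mem_piAntidiag.mp β.2).1
        rw [Fin.sum_univ_succ] at h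
        ext1
        have h0 : n - ∑ i, Fin.tail β.1 i = β.1 0 := by
          simp only [Fin.tail]
          omega
        simp only [h0]
        exact Fin.cons_self_tail _ }
  rw [Nat.card_congr e, Nat.card_eq_fintype_card, Fintype.card_coe, ← Finset.map_sym_eq_piAntidiag,
    Finset.card_map, Finset.sym_univ, Finset.card_univ, Sym.card_sym_eq_choose, Fintype.card_fin,
    show d + 1 + n - 1 = d + n by omega, Nat.choose_symm_add]

variable {d : ℕ}

/-- A continuous function vanishing a.e. vanishes everywhere. Dividing by `√V` leaves a polynomial
that vanishes on the cube `[-1, 1]^d`, hence is zero. The cube lies in the ball of radius `√d ≤ d`,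
which explains the radius in `hpos`. -/
theorem linearIndependent_polyVec {V : EuclideanSpace ℝ (Fin d) → ℝ} (hV : Continuous V)
    (hVc : HasCompactSupport V) (hpos : ∀ x : EuclideanSpace ℝ (Fin d), ‖x‖ ≤ d → 0 < V x)
    (n : ℕ) : LinearIndependent ℂ
      (fun α : {α : Fin d → ℕ // ∑ i, α i ≤ n} => polyVec hV hVc α) := by
  have : Fintype {α : Fin d → ℕ // ∑ i, α i ≤ n} := Fintype.ofFinite _
  rw [Fintype.linearIndependent_iff]
  intro c hc β
  set F : EuclideanSpace ℝ (Fin d) → ℂ := fun x => ∑ α : {α : Fin d → ℕ // ∑ i, α i ≤ n},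
    c α * (((∏ i, x i ^ α.1 i) * √(V x) : ℝ) : ℂ) with hF
  have hFc : Continuous F := by fun_prop
  have hFae : F =ᵐ[volume] fun _ => (0 : ℂ) := by
    have h1 := Lp.coeFn_finsetSum Finset.univ
      (fun α : {α : Fin d → ℕ // ∑ i, α i ≤ n} => c α • polyVec hV hVc α)
    rw [hc] at h1
    have h2 : ∀ᵐ x, ∀ α : {α : Fin d → ℕ // ∑ i, α i ≤ n}, (c α • polyVec hV hVc α : L2Space d) x =
        c α * (((∏ i, x i ^ α.1 i) * √(V x) : ℝ) : ℂ) := by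
      rw [ae_all_iff]
      intro α
      filter_upwards [Lp.coeFn_smul (c α) (polyVec hV hVc α),
        (memLp_monomial_mul_sqrt hV hVc α.1).coeFn_toLp] with x h3 h4
      rw [h3, Pi.smul_apply, polyVec, h4, smul_eq_mul]
    filter_upwards [h1, h2, Lp.coeFn_zero ℂ 2
      (volume : Measure (EuclideanSpace ℝ (Fin d)))] with x h3 h4 h5
    rw [h5, Finset.sum_apply] at h3
    simp only [hF]
    rw [← Finset.sum_congr rfl fun α _ => h4 α, ← h3]
    rfl
  have hF0 : F = fun _ => (0 : ℂ) := (hFc.ae_eq_iff_eq volume continuous_const).mp hFae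
  set P : MvPolynomial (Fin d) ℂ := ∑ α : {α : Fin d → ℕ // ∑ i, α i ≤ n},
    MvPolynomial.monomial (Finsupp.equivFunOnFinite.symm α.1) (c α) with hP
  have hP0 : P = 0 := by
    refine MvPolynomial.funext_set (fun _ => Complex.ofReal '' Set.Icc (-1) 1)
      (fun _ => (Set.Icc_infinite (by norm_num)).image Complex.ofReal_injective.injOn)
      fun x hx => ?_
    choose y hy1 hy2 using fun i => hx i (Set.mem_univ i)
    have hnorm : ‖(WithLp.toLp 2 y : EuclideanSpace ℝ (Fin d))‖ ≤ d := by
      rw [EuclideanSpace.norm_eq, Real.sqrt_le_left (by positivity)]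
      calc ∑ i, ‖y i‖ ^ 2 ≤ ∑ i : Fin d, (1 : ℝ) := by
            refine Finset.sum_le_sum fun i _ => ?_
            rw [Real.norm_eq_abs, sq_abs]
            have := hy1 i
            rw [Set.mem_Icc] at this
            nlinarith
        _ = d := by simp
        _ ≤ (d : ℝ) ^ 2 := by exact_mod_cast Nat.le_self_pow two_ne_zero d
    have h1 := congrFun hF0 (WithLp.toLp 2 y)
    have hs : (√(V (WithLp.toLp 2 y)) : ℂ) ≠ 0 := by
      exact_mod_cast (Real.sqrt_pos.mpr (hpos _ hnorm)).ne'
    have h2 : F (WithLp.toLp 2 y) = MvPolynomial.eval x P * √(V (WithLp.toLp 2 y)) := by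
      rw [hP, map_sum, Finset.sum_mul]
      refine Finset.sum_congr rfl fun α _ => ?_
      rw [MvPolynomial.eval_monomial, Finsupp.prod_fintype _ _ (fun i => pow_zero _)]
      push_cast
      simp [hy2, mul_assoc]
    rw [h2] at h1
    rw [map_zero]
    exact (mul_eq_zero.mp h1).resolve_right hs
  have hcoef := congrArg (MvPolynomial.coeff (Finsupp.equivFunOnFinite.symm β.1)) hP0
  rw [hP, MvPolynomial.coeff_sum, Finset.sum_eq_single β] at hcoef
  · rwa [MvPolynomial.coeff_monomial, if_pos rfl, MvPolynomial.coeff_zero] at hcoef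
  · intro α _ hα
    rw [MvPolynomial.coeff_monomial, if_neg]
    exact fun h => hα (Subtype.ext (Finsupp.equivFunOnFinite.symm.injective h))
  · intro h
    exact absurd (Finset.mem_univ _) h

theorem dimENat_polySpan_eq_choose {V : EuclideanSpace ℝ (Fin d) → ℝ} (hV : Continuous V)
    (hVc : HasCompactSupport V) (hpos : ∀ x : EuclideanSpace ℝ (Fin d), ‖x‖ ≤ d → 0 < V x)
    (n : ℕ) : dimENat (polySpan d n V) = (d + n).choose d := by
  have : Fintype {α : Fin d → ℕ // ∑ i, α i ≤ n} := Fintype.ofFinite _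
  have := finiteDimensional_polySpan hV hVc n
  rw [dimENat_eq_finrank, polySpan_eq_span_range hV hVc,
    finrank_span_eq_card (linearIndependent_polyVec hV hVc hpos n), ← Nat.card_eq_fintype_card,
    natCard_bounded_multiindex]

theorem exists_isTestPotential_pos (d : ℕ) : ∃ V : EuclideanSpace ℝ (Fin d) → ℝ,
    IsTestPotential V ∧ ∀ x : EuclideanSpace ℝ (Fin d), ‖x‖ ≤ d → 0 < V x := by
  let f : ContDiffBump (0 : EuclideanSpace ℝ (Fin d)) :=
    { rIn := d + 1, rOut := d + 2, rIn_pos := by positivity, rIn_lt_rOut := by linarith }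
  refine ⟨f, ⟨f.contDiff, f.hasCompactSupport, fun x => f.nonneg⟩, fun x hx => ?_⟩
  apply f.pos_of_mem_ball
  rw [mem_ball_zero_iff]
  show ‖x‖ < (d : ℝ) + 2
  linarith

theorem IsTestPotential.const_mul {V : EuclideanSpace ℝ (Fin d) → ℝ} (hV : IsTestPotential V)
    {t : ℝ} (ht : 0 ≤ t) : IsTestPotential fun x => t * V x :=
  ⟨contDiff_const.mul hV.smooth, hV.compact_support.mul_left, fun x => mul_nonneg ht (hV.nonneg x)⟩

theorem continuous_boundWeight {s : ℝ} (hs : (d : ℝ) / 2 < s) : Continuous (boundWeight d s) := by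
  unfold boundWeight
  split_ifs
  · have h1 : ∀ x : EuclideanSpace ℝ (Fin d), √(1 + ‖x‖ ^ 2) ≠ 0 := fun x =>
      (Real.sqrt_pos.mpr (by positivity)).ne'
    have h2 : Continuous fun x : EuclideanSpace ℝ (Fin d) => √(1 + ‖x‖ ^ 2) := by fun_prop
    exact (h2.rpow_const fun x => Or.inl (h1 x)).mul (continuous_const.add (h2.log h1)).sqrt
  · exact continuous_norm.rpow_const fun x => Or.inr (by linarith)

/-- Finiteness is what lets the norm of `tV` tend to zero with `t`. The weight is continuous, also
at the origin, because its exponent is positive. -/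
theorem weightedNormSq_lt_top {s : ℝ} (hs : (d : ℝ) / 2 < s)
    {V : EuclideanSpace ℝ (Fin d) → ℝ} (hV : IsTestPotential V) : weightedNormSq d s V < ⊤ := by
  have hc : Continuous fun x => boundWeight d s x * √(V x) :=
    (continuous_boundWeight hs).mul hV.smooth.continuous.sqrt
  exact ENNReal.pow_lt_top
    (hc.memLp_of_hasCompactSupport (hV.compact_support.sqrt_comp.mul_left)).eLpNorm_lt_top

theorem weightedNormSq_const_mul (s : ℝ) (V : EuclideanSpace ℝ (Fin d) → ℝ) {t : ℝ} (ht : 0 ≤ t) :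
    weightedNormSq d s (fun x => t * V x) = ENNReal.ofReal t * weightedNormSq d s V := by
  have h1 : (fun x => boundWeight d s x * √(t * V x)) =
      √t • fun x => boundWeight d s x * √(V x) := by
    ext x
    rw [Pi.smul_apply, Real.sqrt_mul ht, smul_eq_mul]
    ring
  rw [weightedNormSq, weightedNormSq, h1, eLpNorm_const_smul, mul_pow,
    Real.enorm_of_nonneg (Real.sqrt_nonneg t), ← ENNReal.ofReal_pow (Real.sqrt_nonneg t),
    Real.sq_sqrt ht]

end Sharpness

theorem mainTheorem6 (d : ℕ) (hd : 1 ≤ d) (s : ℝ) (hs : (d : ℝ) / 2 ≤ s) :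
    (∀ V : EuclideanSpace ℝ (Fin d) → ℝ, IsTestPotential V →
      dimENat (polySpan d ⌊s - (d : ℝ) / 2⌋₊ V) ≤ numNegEigenvalues (fracSchrodinger d s V)) ∧
    (∃ V : EuclideanSpace ℝ (Fin d) → ℝ, IsTestPotential V ∧
      dimENat (polySpan d ⌊s - (d : ℝ) / 2⌋₊ V) = (d + ⌊s - (d : ℝ) / 2⌋₊).choose d) ∧
    ((d : ℝ) / 2 < s → ∀ a : ℝ≥0, a < (d + ⌊s - (d : ℝ) / 2⌋₊).choose d →
      ¬ ∃ C : ℝ≥0, ∀ V : EuclideanSpace ℝ (Fin d) → ℝ, IsTestPotential V →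
        ((numNegEigenvalues (fracSchrodinger d s V) : ℕ∞) : ℝ≥0∞) ≤
          a + C * weightedNormSq d s V) := by
  obtain ⟨V, hV, hpos⟩ := exists_isTestPotential_pos d
  refine ⟨fun V hV => le_numNegEigenvalues hd hs hV, ⟨V, hV,
    dimENat_polySpan_eq_choose hV.smooth.continuous hV.compact_support hpos _⟩, ?_⟩
  rintro hs' a ha ⟨C, hC⟩
  set N := (d + ⌊s - (d : ℝ) / 2⌋₊).choose d
  -- The supposed bound is applied to `tV` with `t = 1/(k+1)`, which is still positive on the ball
  -- of radius `d`, so the left side stays at least `N` while the norm term vanishes in the limit.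
  have hle : ∀ k : ℕ, (N : ℝ≥0∞) ≤
      a + C * (ENNReal.ofReal (1 / ((k : ℝ) + 1)) * weightedNormSq d s V) := fun k => by
    have ht : (0 : ℝ) < 1 / ((k : ℝ) + 1) := Nat.one_div_pos_of_nat
    have hVt := hV.const_mul ht.le
    rw [← weightedNormSq_const_mul s V ht.le]
    refine le_trans ?_ (hC _ hVt)
    have h1 := le_numNegEigenvalues hd hs hVt
    rw [dimENat_polySpan_eq_choose hVt.smooth.continuous hVt.compact_support
      (fun x hx => mul_pos ht (hpos x hx))] at h1
    exact_mod_cast ENat.toENNReal_le.mpr h1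
  have hlim : Filter.Tendsto (fun k : ℕ => (a : ℝ≥0∞) +
      C * (ENNReal.ofReal (1 / ((k : ℝ) + 1)) * weightedNormSq d s V)) Filter.atTop
      (nhds (a : ℝ≥0∞)) := by
    have h1 := ENNReal.tendsto_ofReal (tendsto_one_div_add_atTop_nhds_zero_nat (𝕜 := ℝ))
    have h2 := ENNReal.Tendsto.mul_const h1 (Or.inr (weightedNormSq_lt_top hs' hV).ne)
    have h3 := ENNReal.Tendsto.const_mul (a := (C : ℝ≥0∞)) h2 (Or.inr ENNReal.coe_ne_top)
    simpa using h3.const_add (a : ℝ≥0∞)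
  have h4 : (N : ℝ≥0∞) ≤ a := ge_of_tendsto' hlim hle
  have h5 : (N : ℝ≥0) ≤ a := by exact_mod_cast h4
  exact absurd h5 (not_le.mpr ha)
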